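/- **Notation.** For a locally finite graph $G$ let $d^{(G)}_v$ be the degree of $v$. For a rooted tree $(G_\infty,\phi)$ let $d_v$ be the number of offspring of $v$, so that $d_\phi=d^{(G_\infty)}_\phi$ and $d_v=d^{(G_\infty)}_v-1$ for $v\neq\phi$; for any rooted graph $(G_\infty,\phi)$ we also write $d_\phi=d^{(G_\infty)}_\phi$. The non-backtracking walk on a tree starts at $\phi$ and moves at each step to a uniformly chosen offspring of its current position. The backtracking walk on a graph starts at $\phi$ and moves at each step to a uniformly chosen neighbour. With $P^k(\phi,j)$ the probability that the walk is at $j$ after $k$ steps, the $k$-level friendship bias of the root is $$\Delta_\phi^{(k)}=\sum_{j}P^k(\phi,j)\,d^{(G_\infty)}_j-d_\phi ,$$ and $\mu^{(k)}_\infty$ is its law when $(G_\infty,\phi)$ is random. Let $\mathscr G$ be the space of connected locally finite rooted graphs up to isomorphism with the metric $1/(1+\sup\{r: B_r^{(H_1)}(o_1)\simeq B_r^{(H_2)}(o_2)\})$. Random graphs $G_n$ on $[n]$ converge locally in probability to a random element $(G_\infty,\phi)$ of $\mathscr G$ (with deterministic law) if for every bounded continuous $h:\mathscr G\to\mathbb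 R$ we have $\frac1n\sum_{i\in[n]}h(\mathscr C(G_n,i))\to\mathbb E[h((G_\infty,\phi))]$ in probability, where $\mathscr C(G_n,i)$ is the connected component of $i$ rooted at $i$. **Theorem.** (a) *Non-backtracking exploration.* Let $G_n$ be simple random graphs on $[n]$ which for all sufficiently large $n$ almost surely have minimum degree at least $3$, and let $G_n$ converge locally in probability to $(G_\infty,\phi)$ (with deterministic law), an almost surely locally finite infinite rooted random tree in which every vertex has at least one offspring. Label the vertices other than $\phi$ by $1,2,\dots$ (and $\phi$ by $0$) in the order of an exploration of the tree: every vertex has a smaller label than its offspring, and for $i<j$ whether $i$ is the parent of $j$ is a deterministic function of the offspring numbers of the vertices labelled $0,\dots,j-1$ (for example, breadth-first order). Suppose that $d_\phi$ is independent of $(d_i)_{i\in\mathbb N}$, and that $(d_i)_{i\in\mathbb N}$ are i.i.d. with a finite second moment. Then $m^{(1)}=\mathbb E[d_\phi]$ and $m^{(2)}=\mathbb E[d_\phi^2]$ are finite and, as $k\to\infty$, $$\Delta_\phi^{(k)}\longrightarrow \Delta_\phi=\frac{m^{(2)}}{m^{(1)}}-d_\phi\quad\text{in probability.}$$ In particular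 $\mu_\infty^{(k)}\Longrightarrow\mu$, where $\mu$ is the law of $\Delta_\phi$. (b) *Backtracking exploration.* Let $(G_\infty,\phi)$ be a connected rooted random simple graph that is almost surely finite and non-bipartite. Then, as $k\to\infty$, $$\Delta_\phi^{(k)}\longrightarrow \Delta_\phi^{\star}=\frac{\sum_{j\in V(G_\infty)}(d_j^{(G_\infty)})^2}{\sum_{j\in V(G_\infty)}d_j^{(G_\infty)}}-d_\phi\quad\text{almost surely.}$$ In particular $\mu_\infty^{(k)}\Longrightarrow\mu^\star$, where $\mu^\star$ is the law of $\Delta_\phi^\star$. -/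

import Mathlib

open MeasureTheory ProbabilityTheory Filter
open scoped Topology ENNReal BoundedContinuousFunction

noncomputable section

namespace FriendBias

/-! ### Degrees and offspring -/

/-- The degree of `v` in a locally finite graph. -/
def deg {V : Type} (G : SimpleGraph V) (v : V) : ℕ := (G.neighborSet v).ncard

/-- In the graph `G` rooted at `o`, the vertex `j` is an offspring of the vertex `i`. -/
def IsOffspring {V : Type} (G : SimpleGraph V) (o i j : V) : Prop :=
  G.Adj i j ∧ G.dist o j = G.dist o i + 1

/-- The number `d_i` of offspring of the vertex `i` in the graph `G` rooted at `o`. -/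
def offspring {V : Type} (G : SimpleGraph V) (o i : V) : ℕ := {j | IsOffspring G o i j}.ncard

/-! ### The explorations and the `k`-level friendship bias of the root -/

open Classical in
/-- One step of the non-backtracking walk started at the root `o` of a tree: the walk moves to an
offspring of its current position chosen uniformly at random. -/
def nonBacktrackingStep {V : Type} (G : SimpleGraph V) (o i j : V) : ℝ :=
  if IsOffspring G o i j then 1 / (offspring G o i : ℝ) else 0

open Classical in
/-- One step of the backtracking walk: the walk moves to a neighbour of its current position
chosen uniformly at random. -/
def backtrackingStep {V : Type} (G : SimpleGraph V) (i j : V) : ℝ :=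
  if G.Adj i j then 1 / (deg G i : ℝ) else 0

open Classical in
/-- The probability that the Markov chain with one-step transition probabilities `Q`, started
at `o`, is at `j` after `k` steps. -/
def walkProb {V : Type} (Q : V → V → ℝ) (o : V) : ℕ → V → ℝ
  | 0, j => if j = o then 1 else 0
  | k + 1, j => ∑' i, walkProb Q o k i * Q i j

/-- The expected degree of the position after `k` steps, minus the degree of the root. -/
def levelBias {V : Type} (G : SimpleGraph V) (o : V) (Q : V → V → ℝ) (k : ℕ) : ℝ :=
  ∑' j, walkProb Q o k j * (deg G j : ℝ) - (deg G o : ℝ)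

/-- The `k`-level friendship bias of the root `o`, non-backtracking exploration. -/
def nonBacktrackingBias {V : Type} (G : SimpleGraph V) (o : V) (k : ℕ) : ℝ :=
  levelBias G o (nonBacktrackingStep G o) k

/-- The `k`-level friendship bias of the root `o`, backtracking exploration. -/
def backtrackingBias {V : Type} (G : SimpleGraph V) (o : V) (k : ℕ) : ℝ :=
  levelBias G o (backtrackingStep G) k

/-- The stationary friendship bias of the root `o` of a finite graph. -/
def stationaryBias {V : Type} (G : SimpleGraph V) (o : V) : ℝ :=
  (∑' j, (deg G j : ℝ) ^ 2) / (∑' j, (deg G j : ℝ)) - (deg G o : ℝ)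

/-! ### The space of rooted graphs with the local metric -/

/-- Connected locally finite rooted graphs. They are not identified up to isomorphism:
isomorphic rooted graphs are at distance `0` below, so that continuous and Borel measurable
functions on this space are the same as on the space of isomorphism classes. -/
structure RootedGraph where
  V : Type
  graph : SimpleGraph V
  root : V
  connected : graph.Connected
  locallyFinite : ∀ v, (graph.neighborSet v).Finite

namespace RootedGraph

/-- The vertices at graph distance at most `r` from the root. -/
def ballSet (x : RootedGraph) (r : ℕ) : Set x.V := {v | x.graph.dist x.root v ≤ r}

theorem root_mem_ballSet (x : RootedGraph) (r : ℕ) : x.root ∈ x.ballSet r := by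
  simp [ballSet]

/-- The balls of radius `r` around the roots are isomorphic as rooted graphs. -/
def BallIso (r : ℕ) (x y : RootedGraph) : Prop :=
  ∃ f : x.graph.induce (x.ballSet r) ≃g y.graph.induce (y.ballSet r),
    f ⟨x.root, x.root_mem_ballSet r⟩ = ⟨y.root, y.root_mem_ballSet r⟩

theorem BallIso.refl (r : ℕ) (x : RootedGraph) : BallIso r x x :=
  ⟨SimpleGraph.Iso.refl, rfl⟩

theorem BallIso.symm {r : ℕ} {x y : RootedGraph} (h : BallIso r x y) : BallIso r y x := by
  obtain ⟨f, hf⟩ := h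
  exact ⟨f.symm, by rw [← hf]; exact f.symm_apply_apply _⟩

theorem BallIso.trans {r : ℕ} {x y z : RootedGraph} (h : BallIso r x y) (h' : BallIso r y z) :
    BallIso r x z := by
  obtain ⟨f, hf⟩ := h
  obtain ⟨g, hg⟩ := h'
  exact ⟨g.comp f, by
    change g (f _) = _
    rw [hf, hg]⟩

theorem exists_adj_of_dist_succ (x : RootedGraph) {v : x.V} {n : ℕ}
    (h : x.graph.dist x.root v = n + 1) :
    ∃ u, x.graph.Adj u v ∧ x.graph.dist x.root u = n := by
  obtain ⟨p, hp⟩ := x.connected.exists_walk_length_eq_dist v x.root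
  cases p with
  | nil => simp at h
  | @cons _ u _ hadj q =>
    refine ⟨u, hadj.symm, ?_⟩
    have h1 : x.graph.dist u x.root ≤ q.length := SimpleGraph.dist_le q
    have h2 := x.connected.dist_triangle (u := x.root) (v := u) (w := v)
    have h3 : x.graph.dist u v = 1 := SimpleGraph.dist_eq_one_iff_adj.mpr hadj.symm
    rw [SimpleGraph.Walk.length_cons, x.graph.dist_comm] at hp
    rw [x.graph.dist_comm] at h1
    omega

theorem dist_le_of_ballIso {r : ℕ} {x y : RootedGraph}
    (f : x.graph.induce (x.ballSet r) ≃g y.graph.induce (y.ballSet r))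
    (hf : f ⟨x.root, x.root_mem_ballSet r⟩ = ⟨y.root, y.root_mem_ballSet r⟩) :
    ∀ (n : ℕ) (v : x.ballSet r), x.graph.dist x.root v = n →
      y.graph.dist y.root (f v) ≤ n := by
  intro n
  induction n with
  | zero =>
    intro v hv
    have h0 : x.root = (v : x.V) := (x.connected.dist_eq_zero_iff).mp hv
    have h1 : v = ⟨x.root, x.root_mem_ballSet r⟩ := Subtype.ext h0.symm
    rw [h1, hf]
    simp
  | succ n ih =>
    intro v hv
    obtain ⟨u, hu, hun⟩ := x.exists_adj_of_dist_succ hv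
    have hv' : x.graph.dist x.root v ≤ r := v.2
    have hur : u ∈ x.ballSet r := by
      change x.graph.dist x.root u ≤ r
      omega
    have h1 := ih ⟨u, hur⟩ hun
    have hadj : (y.graph.induce (y.ballSet r)).Adj (f ⟨u, hur⟩) (f v) :=
      f.map_rel_iff.mpr hu
    have hadj' : y.graph.Adj (f ⟨u, hur⟩ : y.V) (f v : y.V) := hadj
    have h2 := y.connected.dist_triangle (u := y.root) (v := (f ⟨u, hur⟩ : y.V))
      (w := (f v : y.V))
    have h3 := SimpleGraph.dist_eq_one_iff_adj.mpr hadj'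
    omega

theorem BallIso.mono {r s : ℕ} (hrs : r ≤ s) {x y : RootedGraph} (h : BallIso s x y) :
    BallIso r x y := by
  obtain ⟨f, hf⟩ := h
  have hf' : f.symm ⟨y.root, y.root_mem_ballSet s⟩ = ⟨x.root, x.root_mem_ballSet s⟩ := by
    rw [← hf]; exact f.symm_apply_apply _
  have hsub : ∀ z : RootedGraph, z.ballSet r ⊆ z.ballSet s :=
    fun z v (hv : z.graph.dist z.root v ≤ r) => le_trans hv hrs
  have h1 : ∀ v : x.ballSet r, (f ⟨v, hsub x v.2⟩ : y.V) ∈ y.ballSet r :=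
    fun v => le_trans (dist_le_of_ballIso f hf _ ⟨v, hsub x v.2⟩ rfl) v.2
  have h2 : ∀ v : y.ballSet r, (f.symm ⟨v, hsub y v.2⟩ : x.V) ∈ x.ballSet r :=
    fun v => le_trans (dist_le_of_ballIso f.symm hf' _ ⟨v, hsub y v.2⟩ rfl) v.2
  refine ⟨⟨⟨fun v => ⟨_, h1 v⟩, fun v => ⟨_, h2 v⟩, fun v => ?_, fun v => ?_⟩, ?_⟩, ?_⟩
  · apply Subtype.ext
    simp
  · apply Subtype.ext
    simp
  · intro a b
    exact f.map_rel_iff (a := ⟨a, hsub x a.2⟩) (b := ⟨b, hsub x b.2⟩)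
  · apply Subtype.ext
    change ((f ⟨x.root, _⟩ : y.ballSet s) : y.V) = y.root
    rw [hf]

/-- The supremum of the radii for which the balls around the roots are isomorphic. -/
def agreement (x y : RootedGraph) : ℝ≥0∞ := ⨆ r : {r : ℕ // BallIso r x y}, (r.1 : ℝ≥0∞)

theorem agreement_self (x : RootedGraph) : agreement x x = ⊤ := by
  refine ENNReal.eq_top_of_forall_nnreal_le fun q => ?_
  obtain ⟨n, hn⟩ := exists_nat_ge q
  refine le_trans ?_ (le_iSup _ ⟨n, BallIso.refl n x⟩)
  exact_mod_cast hn

theorem agreement_le_symm (x y : RootedGraph) : agreement x y ≤ agreement y x :=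
  iSup_le fun r => le_iSup_of_le (⟨r.1, r.2.symm⟩ : {r : ℕ // BallIso r y x}) le_rfl

theorem min_agreement_le (x y z : RootedGraph) :
    min (agreement x y) (agreement y z) ≤ agreement x z := by
  by_contra! h
  obtain ⟨h1, h2⟩ := lt_min_iff.mp h
  obtain ⟨r, hr⟩ := lt_iSup_iff.mp h1
  obtain ⟨s, hs⟩ := lt_iSup_iff.mp h2
  have hxz : BallIso (min r.1 s.1) x z :=
    (r.2.mono (min_le_left _ _)).trans (s.2.mono (min_le_right _ _))
  have h3 : ((min r.1 s.1 : ℕ) : ℝ≥0∞) ≤ agreement x z :=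
    le_iSup (fun r : {r : ℕ // BallIso r x z} => (r.1 : ℝ≥0∞)) ⟨_, hxz⟩
  rcases min_choice r.1 s.1 with h4 | h4 <;> rw [h4] at h3
  · exact absurd h3 (not_le.mpr hr)
  · exact absurd h3 (not_le.mpr hs)

/-- The local distance `1 / (1 + sup {r | the balls of radius r are isomorphic})`. -/
instance : PseudoEMetricSpace RootedGraph where
  edist x y := (1 + agreement x y)⁻¹
  edist_self x := by simp [agreement_self]
  edist_comm x y := by rw [le_antisymm (agreement_le_symm x y) (agreement_le_symm y x)]
  edist_triangle x y z := by
    have h := min_agreement_le x y z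
    rcases min_le_iff.mp h with h | h
    · exact le_trans (ENNReal.inv_le_inv.mpr (by gcongr)) le_self_add
    · exact le_trans (ENNReal.inv_le_inv.mpr (by gcongr)) le_add_self

instance : MeasurableSpace RootedGraph := borel RootedGraph

instance : BorelSpace RootedGraph := ⟨rfl⟩

end RootedGraph

open Classical in
/-- The connected component of the vertex `v` of `G`, rooted at `v`. It is used only when that
component is locally finite; otherwise the value is the graph with a single vertex. -/
def rootedComponent {V : Type} (G : SimpleGraph V) (v : V) : RootedGraph :=
  if h : ∀ w, ((G.connectedComponentMk v).toSimpleGraph.neighborSet w).Finite then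
    { V := G.connectedComponentMk v
      graph := (G.connectedComponentMk v).toSimpleGraph
      root := ⟨v, rfl⟩
      connected := (G.connectedComponentMk v).connected_toSimpleGraph
      locallyFinite := h }
  else
    { V := Unit
      graph := ⊥
      root := ()
      connected := SimpleGraph.Connected.mk (fun _ _ => .refl _)
      locallyFinite := fun _ => Set.toFinite _ }

/-- Local convergence in probability of the random graphs `G n` on `n` vertices to the random
rooted graph `X` (with law `Q.map X`): for every bounded continuous function `h` of
rooted graphs, the conditional expectation given `G n` of `h` at the component of a uniformly
chosen root converges in probability to the expectation of `h (X)`. -/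
def LocallyConvergesInProbability {Ω : ℕ → Type*} [∀ n, MeasurableSpace (Ω n)]
    (P : ∀ n, Measure (Ω n)) (G : ∀ n, Ω n → SimpleGraph (Fin n))
    {Ω' : Type*} [MeasurableSpace Ω'] (Q : Measure Ω') (X : Ω' → RootedGraph) : Prop :=
  ∀ h : RootedGraph →ᵇ ℝ, ∀ ε : ℝ, 0 < ε →
    Tendsto (fun n => P n {ω | ε ≤ |(1 / (n : ℝ)) * ∑ i : Fin n, h (rootedComponent (G n ω) i)
      - ∫ ω', h (X ω') ∂Q|}) atTop (𝓝 0)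

/-- The vertices of the random tree `T`, rooted at `0`, are labelled by `ℕ` in the order of an
exploration of the tree: almost surely every vertex has a smaller label than its offspring, and
for all `i < j`, whether `j` is attached to `i` is a (deterministic) function of the offspring
numbers of the vertices `0, …, j - 1`. Breadth-first order is an example. -/
def IsExplorationLabelling {Ω : Type*} [MeasurableSpace Ω] (P : Measure Ω)
    (T : Ω → SimpleGraph ℕ) : Prop :=
  (∀ᵐ ω ∂P, ∀ i j, IsOffspring (T ω) 0 i j → i < j) ∧
  ∀ i j : ℕ, i < j → ∃ S : Set (Fin j → ℕ),
    ∀ᵐ ω ∂P, ((T ω).Adj i j ↔ (fun l : Fin j => offspring (T ω) 0 l) ∈ S)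

end FriendBias

end

namespace FriendBias

/-! ### Random walks with finitely many possible steps -/

/-! Non-backtracking exploration. Write p for the law of d_φ and q for the law of d_1 + 1, the
degree of a non-root vertex. In a finite graph, ordered edges from degree a to degree b are as
numerous as those from b to a (`sum_edgeCount_rootedComponent_comm`). The local limit inherits this
identity in expectation. In the tree, whether the root is joined to j is decided by offspring
numbers of smaller labels, hence is independent of d_j, and the identity becomes a p_a q_b = b p_b
q_a (`integral_edgeCount`). So q is the size-biased version of p (`exists_sizeBiased`), and E[d_1] +
1 = m^(2)/m^(1), with m^(2) finite because d_1 has a finite mean. Minimum degree 3 passes to the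
limit too, so every vertex has at least two offspring, and the walk is at any given vertex after k
steps with probability W_j ≤ 2^(-k). The bias minus its limit is ∑ W_j (d_j - E[d_1]) for k ≥ 1.
Each W_j depends only on offspring numbers of smaller labels, so the terms are orthogonal and the
second moment is Var(d_1) E[∑ W_j^2] ≤ Var(d_1) 2^(-k) (`eLpNorm_two_tsum_le`). Convergence in L^2
gives convergence in probability and in law. Backtracking exploration. On a finite connected
non-bipartite graph some power of the transition matrix is strictly positive, so the walk forgets
its start and converges to the stationary law proportional to the degree
(`tendsto_pow_mulVec_of_doeblin`). The k-level bias depends only on a finite ball, hence is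
continuous in the rooted graph, which supplies measurability. -/

theorem walkProb_nonneg {V : Type} {Q : V → V → ℝ} (hQ : ∀ i j, 0 ≤ Q i j) (o : V) (k : ℕ) (j : V) :
    0 ≤ walkProb Q o k j := by
  induction k generalizing j with
  | zero => simp only [walkProb]; split_ifs <;> norm_num
  | succ k ih => exact tsum_nonneg fun i => mul_nonneg (ih i) (hQ i j)

theorem exists_of_walkProb_succ_ne_zero {V : Type} {Q : V → V → ℝ} {o : V} {k : ℕ} {j : V}
    (h : walkProb Q o (k + 1) j ≠ 0) : ∃ i, walkProb Q o k i ≠ 0 ∧ Q i j ≠ 0 := by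
  by_contra! h'
  refine h ?_
  simp only [walkProb]
  convert tsum_zero with i
  by_cases hi : walkProb Q o k i = 0
  · rw [hi, zero_mul]
  · rw [h' i hi, mul_zero]

theorem walkProb_support_finite {V : Type} {Q : V → V → ℝ}
    (hQ : ∀ i, (Function.support (Q i)).Finite) (o : V) (k : ℕ) :
    (Function.support (walkProb Q o k)).Finite := by
  induction k with
  | zero =>
    refine (Set.finite_singleton o).subset fun j hj => ?_
    by_contra hne
    exact hj (if_neg hne)
  | succ k ih =>
    refine (ih.biUnion fun i _ => hQ i).subset fun j hj => ?_
    obtain ⟨i, hi, hij⟩ := exists_of_walkProb_succ_ne_zero hj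
    exact Set.mem_biUnion hi hij

/-- Conditioning on the position before the last step; finite supports reduce the exchange of sums
to a finite one. -/
theorem tsum_walkProb_succ_mul {V : Type} {Q : V → V → ℝ}
    (hQ : ∀ i, (Function.support (Q i)).Finite) (o : V) (k : ℕ) (f : V → ℝ) :
    ∑' j, walkProb Q o (k + 1) j * f j = ∑' i, walkProb Q o k i * ∑' j, Q i j * f j := by
  classical
  set S := (walkProb_support_finite hQ o k).toFinset with hS
  set U := S.biUnion fun i => (hQ i).toFinset with hU
  have hmemS : ∀ {i}, i ∉ S → walkProb Q o k i = 0 := fun {i} hi => by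
    simpa [hS] using hi
  have hstep : ∀ j, walkProb Q o (k + 1) j = ∑ i ∈ S, walkProb Q o k i * Q i j := fun j =>
    tsum_eq_sum fun i hi => by rw [hmemS hi, zero_mul]
  have hmemU : ∀ {i j}, i ∈ S → j ∉ U → Q i j = 0 := fun {i j} hi hj => by
    by_contra hne
    exact hj (Finset.mem_biUnion.mpr ⟨i, hi, by simpa using hne⟩)
  rw [tsum_eq_sum (s := U), tsum_eq_sum (s := S)]
  · simp_rw [hstep, Finset.sum_mul]
    rw [Finset.sum_comm]
    refine Finset.sum_congr rfl fun i hi => ?_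
    rw [tsum_eq_sum (s := U) fun j hj => by rw [hmemU hi hj, zero_mul], Finset.mul_sum]
    exact Finset.sum_congr rfl fun j _ => mul_assoc _ _ _
  · intro i hi
    rw [hmemS hi, zero_mul]
  · intro j hj
    rw [hstep, Finset.sum_eq_zero fun i hi => by rw [hmemU hi hj, mul_zero], zero_mul]

theorem tsum_walkProb_eq_one {V : Type} {Q : V → V → ℝ}
    (hQ : ∀ i, (Function.support (Q i)).Finite) (hQ1 : ∀ i, ∑' j, Q i j = 1) (o : V) (k : ℕ) :
    ∑' j, walkProb Q o k j = 1 := by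
  induction k with
  | zero =>
    exact (tsum_eq_single o fun j hj => if_neg hj).trans (if_pos rfl)
  | succ k ih =>
    have := tsum_walkProb_succ_mul hQ o k fun _ => 1
    simpa only [mul_one, hQ1, ih] using this

/-! ### Convergence of the simple random walk on a finite non-bipartite graph -/

open Matrix in
-- Doeblin's argument: every row of `M ^ N` dominates ε p. On vectors orthogonal to p this common
-- part acts as zero, and the remainder has row sums 1 - ε, so the sup norm contracts.
theorem tendsto_pow_mulVec_of_doeblin {V : Type*} [Fintype V] [DecidableEq V]
    (M : Matrix V V ℝ) (hM : ∀ i j, 0 ≤ M i j) (hM1 : ∀ i, ∑ j, M i j = 1)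
    (p : V → ℝ) (hp0 : ∀ i, 0 ≤ p i) (hp1 : ∑ i, p i = 1) (hp : p ᵥ* M = p) {N : ℕ}
    (hN : ∀ i j, 0 < (M ^ N) i j) (f : V → ℝ) (i : V) :
    Tendsto (fun k => ((M ^ k) *ᵥ f) i) atTop (𝓝 (p ⬝ᵥ f)) := by
  have : Nonempty V := ⟨i⟩
  have hone : M *ᵥ 1 = 1 := by ext i; simp [mulVec, dotProduct, hM1]
  have honek : ∀ k, (M ^ k) *ᵥ 1 = 1 := by
    intro k
    induction k with
    | zero => simp
    | succ k ih => rw [pow_succ, ← mulVec_mulVec, hone, ih]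
  have hpk : ∀ k, p ᵥ* (M ^ k) = p := by
    intro k
    induction k with
    | zero => simp
    | succ k ih => rw [pow_succ, ← vecMul_vecMul, ih, hp]
  have hple : ∀ j, p j ≤ 1 := fun j => hp1 ▸ Finset.single_le_sum (fun i _ => hp0 i) (Finset.mem_univ j)
  -- ε is the smallest entry of `M ^ N`, capped at 1 to keep 1 - ε nonnegative; it suffices because
  -- p j ≤ 1.
  obtain ⟨ε, hε0, hε1, hε⟩ : ∃ ε : ℝ, 0 < ε ∧ ε ≤ 1 ∧ ∀ i j, ε * p j ≤ (M ^ N) i j := by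
    obtain ⟨x, hx⟩ := Finite.exists_min fun x : V × V => (M ^ N) x.1 x.2
    refine ⟨min ((M ^ N) x.1 x.2) 1, lt_min (hN _ _) one_pos, min_le_right _ _, fun i j => ?_⟩
    calc min ((M ^ N) x.1 x.2) 1 * p j ≤ min ((M ^ N) x.1 x.2) 1 * 1 :=
          mul_le_mul_of_nonneg_left (hple j) (lt_min (hN _ _) one_pos).le
      _ ≤ (M ^ N) i j := by rw [mul_one]; exact (min_le_left _ _).trans (hx (i, j))
  set g : V → ℝ := f - (p ⬝ᵥ f) • (1 : V → ℝ) with hg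
  have hpg : p ⬝ᵥ g = 0 := by
    rw [hg, dotProduct_sub, dotProduct_smul, dotProduct_one, hp1]; simp
  set u : ℕ → V → ℝ := fun k => (M ^ k) *ᵥ g with hu
  have hpu : ∀ k, p ⬝ᵥ u k = 0 := fun k => by
    rw [hu, dotProduct_mulVec, hpk, hpg]
  have hstep : ∀ k, ‖u (k + 1)‖ ≤ ‖u k‖ := fun k => by
    refine (pi_norm_le_iff_of_nonneg (norm_nonneg _)).mpr fun i => ?_
    have h1 : u (k + 1) i = ∑ j, M i j * u k j := by
      simp only [hu]; rw [pow_succ', ← mulVec_mulVec]; rfl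
    rw [h1]
    calc ‖∑ j, M i j * u k j‖ ≤ ∑ j, ‖M i j * u k j‖ := norm_sum_le _ _
      _ ≤ ∑ j, M i j * ‖u k‖ := Finset.sum_le_sum fun j _ => by
          rw [norm_mul, Real.norm_of_nonneg (hM i j)]
          exact mul_le_mul_of_nonneg_left (norm_le_pi_norm _ _) (hM i j)
      _ = ‖u k‖ := by rw [← Finset.sum_mul, hM1, one_mul]
  have hcontr : ∀ k, ‖u (N + k)‖ ≤ (1 - ε) * ‖u k‖ := fun k => by
    refine (pi_norm_le_iff_of_nonneg
      (mul_nonneg (sub_nonneg.mpr hε1) (norm_nonneg _))).mpr fun i => ?_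
    have h1 : u (N + k) i = ∑ j, ((M ^ N) i j - ε * p j) * u k j := by
      have h2 : u (N + k) i = ∑ j, (M ^ N) i j * u k j := by
        simp only [hu]; rw [pow_add, ← mulVec_mulVec]; rfl
      have h3 : ∑ j, p j * u k j = 0 := hpu k
      simp_rw [sub_mul, Finset.sum_sub_distrib, mul_assoc]
      rw [← Finset.mul_sum, h3, h2, mul_zero, sub_zero]
    have h4 : ∑ j, (M ^ N) i j = 1 := by
      have := congrFun (honek N) i
      simpa [mulVec, dotProduct] using this
    rw [h1]
    calc ‖∑ j, ((M ^ N) i j - ε * p j) * u k j‖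
        ≤ ∑ j, ‖((M ^ N) i j - ε * p j) * u k j‖ := norm_sum_le _ _
      _ ≤ ∑ j, ((M ^ N) i j - ε * p j) * ‖u k‖ := Finset.sum_le_sum fun j _ => by
          rw [norm_mul, Real.norm_of_nonneg (sub_nonneg.mpr (hε i j))]
          exact mul_le_mul_of_nonneg_left (norm_le_pi_norm _ _) (sub_nonneg.mpr (hε i j))
      _ = (1 - ε) * ‖u k‖ := by
          rw [← Finset.sum_mul, Finset.sum_sub_distrib, h4, ← Finset.mul_sum, hp1, mul_one]
  have hanti : Antitone fun k => ‖u k‖ := antitone_nat_of_succ_le hstep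
  obtain ⟨L, hL⟩ : ∃ L, Tendsto (fun k => ‖u k‖) atTop (𝓝 L) :=
    ⟨_, tendsto_atTop_ciInf hanti ⟨0, by rintro _ ⟨k, rfl⟩; exact norm_nonneg _⟩⟩
  -- The norms decrease to a limit L, and contraction over N steps gives L ≤ (1 - ε) L.
  have hL0 : L = 0 := by
    have h1 : 0 ≤ L := ge_of_tendsto' hL fun k => norm_nonneg _
    have h2 : L ≤ (1 - ε) * L := by
      refine le_of_tendsto_of_tendsto' ?_ (hL.const_mul (1 - ε)) hcontr
      simpa only [add_comm] using (tendsto_add_atTop_iff_nat N).mpr hL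
    nlinarith
  have hu0 : Tendsto u atTop (𝓝 0) := tendsto_zero_iff_norm_tendsto_zero.mpr (hL0 ▸ hL)
  have hui := (tendsto_pi_nhds.mp hu0 i).add_const (p ⬝ᵥ f)
  simp only [Pi.zero_apply, zero_add] at hui
  refine hui.congr fun k => ?_
  simp only [hu, hg, mulVec_sub, mulVec_smul, honek]
  simp

/-- A walk can be lengthened by 2 by going back and forth along an edge, and a detour through an odd
closed walk changes its parity, so all large lengths occur between any two vertices. -/
theorem exists_walk_length_of_not_isBipartite {V : Type*} [Finite V] {G : SimpleGraph V}
    (hG : G.Connected) (hb : ¬ G.IsBipartite) :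
    ∃ N, ∀ i j, ∃ w : G.Walk i j, w.length = N := by
  obtain ⟨u, c, hc⟩ : ∃ (u : V) (c : G.Walk u u), ¬ Even c.length := by
    by_contra! h
    exact hb (SimpleGraph.two_colorable_iff_forall_loop_even.mpr h)
  have hstretch : ∀ (i j : V) (w : G.Walk i j), ∀ m, ∃ w' : G.Walk i j, w'.length = w.length + 2 * m := by
    intro i j w m
    obtain ⟨x, hx⟩ : ∃ x, G.Adj j x := by
      have : Nontrivial V := by
        cases c with
        | nil => simp at hc
        | cons h _ => exact ⟨_, _, h.ne⟩
      exact hG.preconnected.exists_adj_of_nontrivial j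
    induction m with
    | zero => exact ⟨w, by simp⟩
    | succ m ih =>
      obtain ⟨w', hw'⟩ := ih
      refine ⟨(w'.concat hx).concat hx.symm, ?_⟩
      simp only [SimpleGraph.Walk.length_concat, hw']
      ring
  have hboth : ∀ i j : V, ∃ N₀, ∀ N, N₀ ≤ N → ∃ w : G.Walk i j, w.length = N := by
    intro i j
    obtain ⟨p⟩ := hG.preconnected i u
    obtain ⟨q⟩ := hG.preconnected u j
    refine ⟨p.length + q.length + c.length, fun N hN => ?_⟩
    rw [Nat.not_even_iff_odd] at hc
    by_cases hpar : Even (N - (p.length + q.length))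
    · obtain ⟨m, hm⟩ := hpar
      obtain ⟨w, hw⟩ := hstretch i j (p.append q) m
      exact ⟨w, by rw [hw, SimpleGraph.Walk.length_append]; omega⟩
    · rw [Nat.not_even_iff_odd] at hpar
      obtain ⟨m, hm⟩ := hpar
      obtain ⟨l, hl⟩ := hc
      -- The missing length is 2m + 1, of which the odd closed walk supplies 2l + 1.
      obtain ⟨w, hw⟩ := hstretch i j ((p.append c).append q) (m - l)
      exact ⟨w, by rw [hw, SimpleGraph.Walk.length_append, SimpleGraph.Walk.length_append]; omega⟩
  choose N₀ hN₀ using hboth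
  obtain ⟨B, hB⟩ := (Set.finite_range fun x : V × V => N₀ x.1 x.2).bddAbove
  exact ⟨B, fun i j => hN₀ i j B (hB ⟨(i, j), rfl⟩)⟩

theorem pow_pos_of_walk {V : Type*} [Fintype V] [DecidableEq V] {G : SimpleGraph V}
    {M : Matrix V V ℝ} (hM : ∀ i j, 0 ≤ M i j) (hadj : ∀ i j, G.Adj i j → 0 < M i j)
    {i j : V} (w : G.Walk i j) : 0 < (M ^ w.length) i j := by
  have hnn : ∀ n i j, 0 ≤ (M ^ n) i j := by
    intro n
    induction n with
    | zero => intro i j; rw [pow_zero, Matrix.one_apply]; split_ifs <;> norm_num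
    | succ n ih =>
      intro i j
      rw [pow_succ', Matrix.mul_apply]
      exact Finset.sum_nonneg fun l _ => mul_nonneg (hM i l) (ih l j)
  induction w with
  | nil => simp
  | @cons a b c h q ih =>
    rw [SimpleGraph.Walk.length_cons, pow_succ', Matrix.mul_apply]
    exact lt_of_lt_of_le (mul_pos (hadj _ _ h) ih) (Finset.single_le_sum
      (f := fun l => M a l * (M ^ q.length) l c)
      (fun l _ => mul_nonneg (hM a l) (hnn _ l c)) (Finset.mem_univ b))

theorem backtrackingStep_nonneg {V : Type} (G : SimpleGraph V) (i j : V) :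
    0 ≤ backtrackingStep G i j := by
  unfold backtrackingStep
  split_ifs <;> positivity

theorem backtrackingStep_ne_zero_adj {V : Type} {G : SimpleGraph V} {i j : V}
    (h : backtrackingStep G i j ≠ 0) : G.Adj i j := by
  by_contra h'
  exact h (if_neg h')

theorem sum_ite_one_eq_ncard {V : Type} [Fintype V] (p : V → Prop) [DecidablePred p] :
    ∑ j, (if p j then (1 : ℝ) else 0) = ({j | p j}.ncard : ℝ) := by
  rw [Finset.sum_boole, Set.ncard_eq_toFinset_card']
  simp

open Matrix in
/-- The simple random walk on a finite connected non-bipartite graph converges to its stationary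
distribution. -/
theorem tendsto_backtrackingBias {V : Type} [Finite V] {G : SimpleGraph V} (hG : G.Connected)
    (hb : ¬ G.IsBipartite) (o : V) :
    Tendsto (fun k => backtrackingBias G o k) atTop (𝓝 (stationaryBias G o)) := by
  classical
  have := Fintype.ofFinite V
  obtain ⟨N, hN⟩ := exists_walk_length_of_not_isBipartite hG hb
  have : Nontrivial V := by
    rw [← not_subsingleton_iff_nontrivial]
    intro hs
    exact hb ⟨SimpleGraph.Coloring.mk (fun _ => 0) fun {a b} h => (h.ne (Subsingleton.elim _ _)).elim⟩
  have hdeg : ∀ i, 0 < (deg G i : ℝ) := fun i => by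
    obtain ⟨x, hx⟩ := hG.preconnected.exists_adj_of_nontrivial i
    exact Nat.cast_pos.mpr ((Set.ncard_pos (Set.toFinite _)).mpr ⟨x, hx⟩)
  set M : Matrix V V ℝ := Matrix.of (backtrackingStep G) with hMdef
  have hM : ∀ i j, 0 ≤ M i j := backtrackingStep_nonneg G
  have hMpos : ∀ i j, G.Adj i j → 0 < M i j := fun i j h => by
    simp only [hMdef, Matrix.of_apply, backtrackingStep, if_pos h]
    exact one_div_pos.mpr (hdeg i)
  have hdegsum : ∀ i, (deg G i : ℝ) = ∑ j, if G.Adj i j then (1 : ℝ) else 0 := fun i =>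
    (sum_ite_one_eq_ncard _).symm
  have hM1 : ∀ i, ∑ j, M i j = 1 := fun i => by
    have h1 : ∀ j, M i j = (if G.Adj i j then 1 else 0) * (1 / (deg G i : ℝ)) := fun j => by
      simp only [hMdef, Matrix.of_apply, backtrackingStep]; split_ifs <;> simp
    simp_rw [h1]
    rw [← Finset.sum_mul, ← hdegsum, mul_one_div_cancel (hdeg i).ne']
  set D : ℝ := ∑ i, (deg G i : ℝ) with hD
  have hDpos : 0 < D := Finset.sum_pos (fun i _ => hdeg i) ⟨o, Finset.mem_univ _⟩
  set p : V → ℝ := fun i => (deg G i : ℝ) / D with hp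
  have hpM : p ᵥ* M = p := by
    ext j
    -- Detailed balance: the stationary flow through every edge is 1 / D in each direction.
    have h1 : ∀ i, p i * M i j = (if G.Adj j i then 1 else 0) * (1 / D) := fun i => by
      simp only [hp, hMdef, Matrix.of_apply, backtrackingStep, G.adj_comm j i]
      split_ifs
      · field_simp [(hdeg i).ne']
      · simp
    change ∑ i, p i * M i j = p j
    simp_rw [h1]
    rw [← Finset.sum_mul, ← hdegsum, mul_one_div]
  have hlim := tendsto_pow_mulVec_of_doeblin M hM hM1 p (fun i => div_nonneg (hdeg i).le hDpos.le)
    (by simp only [hp]; rw [← Finset.sum_div, div_self hDpos.ne']) hpM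
    (N := N) (fun i j => by
      obtain ⟨w, hw⟩ := hN i j
      exact hw ▸ pow_pos_of_walk hM hMpos w) (fun j => (deg G j : ℝ)) o
  have hwalk : ∀ k (f : V → ℝ), ∑' j, walkProb (backtrackingStep G) o k j * f j
      = ((M ^ k) *ᵥ f) o := by
    intro k
    induction k with
    | zero => intro f; simp [walkProb, tsum_fintype]
    | succ k ih =>
      intro f
      rw [tsum_walkProb_succ_mul (fun _ => Set.toFinite _), ih, pow_succ, ← mulVec_mulVec]
      congr 2
      ext i
      rw [tsum_fintype]
      rfl
  have hst : stationaryBias G o = p ⬝ᵥ (fun j => (deg G j : ℝ)) - deg G o := by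
    simp only [stationaryBias, tsum_fintype, dotProduct, hp, Finset.sum_div]
    congr 1
    exact Finset.sum_congr rfl fun j _ => by ring
  rw [hst]
  refine (hlim.sub_const _).congr fun k => ?_
  rw [backtrackingBias, levelBias, hwalk]

/-! ### Local functions of rooted graphs -/

namespace RootedGraph

theorem dist_le_succ_of_adj (x : RootedGraph) {v w : x.V} (h : x.graph.Adj v w) :
    x.graph.dist x.root w ≤ x.graph.dist x.root v + 1 := by
  have h1 := x.connected.dist_triangle (u := x.root) (v := v) (w := w)
  rwa [SimpleGraph.dist_eq_one_iff_adj.mpr h] at h1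

/-- A function of rooted graphs that depends only on a ball of fixed radius is continuous. -/
theorem continuous_of_ballIso {α : Type*} [TopologicalSpace α] {F : RootedGraph → α} (r : ℕ)
    (hF : ∀ x y, BallIso r x y → F x = F y) : Continuous F := by
  refine (IsLocallyConstant.iff_eventually_eq F).mpr (fun x => ?_) |>.continuous
  -- Points nearer than 1 / (1 + r) agree on a ball of radius larger than r.
  have hpos : (0 : ℝ≥0∞) < (1 + (r : ℝ≥0∞))⁻¹ :=
    ENNReal.inv_pos.mpr (ENNReal.add_ne_top.mpr ⟨ENNReal.one_ne_top, ENNReal.natCast_ne_top r⟩)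
  filter_upwards [Metric.eball_mem_nhds x hpos] with y hy
  have h1 : (1 + agreement y x)⁻¹ < (1 + (r : ℝ≥0∞))⁻¹ := hy
  have h2 : (r : ℝ≥0∞) < agreement y x := by
    rw [ENNReal.inv_lt_inv] at h1
    exact lt_of_add_lt_add_left h1
  obtain ⟨s, hs⟩ := lt_iSup_iff.mp h2
  exact hF y x (s.2.mono (by exact_mod_cast hs.le))

theorem dist_eq_of_ballIso {r : ℕ} {x y : RootedGraph}
    (f : x.graph.induce (x.ballSet r) ≃g y.graph.induce (y.ballSet r))
    (hf : f ⟨x.root, x.root_mem_ballSet r⟩ = ⟨y.root, y.root_mem_ballSet r⟩)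
    (v : x.ballSet r) :
    y.graph.dist y.root (f v) = x.graph.dist x.root v := by
  refine le_antisymm (dist_le_of_ballIso f hf _ v rfl) ?_
  have h := dist_le_of_ballIso f.symm (by rw [← hf]; exact f.symm_apply_apply _) _ (f v) rfl
  rwa [f.symm_apply_apply] at h

/-- All neighbours of a vertex at distance less than r lie in the ball, so `f` matches
neighbourhoods. The predicates let the same argument serve degrees and edge counts. -/
theorem ncard_adj_eq_of_ballIso {r : ℕ} {x y : RootedGraph}
    (f : x.graph.induce (x.ballSet r) ≃g y.graph.induce (y.ballSet r))
    (hf : f ⟨x.root, x.root_mem_ballSet r⟩ = ⟨y.root, y.root_mem_ballSet r⟩)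
    (v : x.ballSet r) (hv : x.graph.dist x.root v < r)
    {A : x.V → Prop} {B : y.V → Prop}
    (hAB : ∀ j : x.ballSet r, x.graph.Adj v j → (A j ↔ B (f j))) :
    {j | x.graph.Adj v j ∧ A j}.ncard = {j | y.graph.Adj (f v) j ∧ B j}.ncard := by
  have hx : ∀ j, x.graph.Adj v j → j ∈ x.ballSet r := fun j hj =>
    (x.dist_le_succ_of_adj hj).trans hv
  have hy : ∀ j, y.graph.Adj (f v) j → j ∈ y.ballSet r := fun j hj => by
    have h := y.dist_le_succ_of_adj hj
    rw [dist_eq_of_ballIso f hf] at h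
    exact h.trans hv
  refine Set.ncard_congr (fun j hj => (f ⟨j, hx j hj.1⟩ : y.V)) ?_ ?_ ?_
  · intro j hj
    exact ⟨f.map_rel_iff.mpr (show (x.graph.induce _).Adj v ⟨j, hx j hj.1⟩ from hj.1),
      (hAB ⟨j, hx j hj.1⟩ hj.1).mp hj.2⟩
  · intro i j hi hj hij
    exact congrArg Subtype.val (f.injective (Subtype.ext hij))
  · intro j hj
    obtain ⟨i, hi⟩ := f.surjective ⟨j, hy j hj.1⟩
    have hadj : x.graph.Adj v i := by
      refine f.map_rel_iff.mp (show (y.graph.induce _).Adj (f v) (f i) from ?_)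
      rw [hi]
      exact hj.1
    have hij : (f i : y.V) = j := congrArg Subtype.val hi
    exact ⟨i, ⟨hadj, (hAB i hadj).mpr (hij.symm ▸ hj.2)⟩, hij⟩

theorem deg_eq_of_ballIso {r : ℕ} {x y : RootedGraph}
    (f : x.graph.induce (x.ballSet r) ≃g y.graph.induce (y.ballSet r))
    (hf : f ⟨x.root, x.root_mem_ballSet r⟩ = ⟨y.root, y.root_mem_ballSet r⟩)
    (v : x.ballSet r) (hv : x.graph.dist x.root v < r) :
    deg y.graph (f v) = deg x.graph v := by
  have h := ncard_adj_eq_of_ballIso f hf v hv (A := fun _ => True) (B := fun _ => True)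
    fun _ _ => Iff.rfl
  simp only [and_true] at h
  exact h.symm

theorem dist_le_of_walkProb_ne_zero (x : RootedGraph) {m : ℕ} {v : x.V}
    (h : walkProb (backtrackingStep x.graph) x.root m v ≠ 0) : x.graph.dist x.root v ≤ m := by
  induction m generalizing v with
  | zero =>
    have hv : v = x.root := by
      by_contra hne
      exact h (if_neg hne)
    simp [hv]
  | succ m ih =>
    obtain ⟨i, hi, hij⟩ := exists_of_walkProb_succ_ne_zero h
    have h1 := ih hi
    have h2 := x.dist_le_succ_of_adj (backtrackingStep_ne_zero_adj hij)
    omega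

theorem tsum_eq_of_ballIso {r : ℕ} {x y : RootedGraph}
    (f : x.graph.induce (x.ballSet r) ≃g y.graph.induce (y.ballSet r)) {F : x.V → ℝ} {H : y.V → ℝ}
    (hF : Function.support F ⊆ x.ballSet r) (hH : Function.support H ⊆ y.ballSet r)
    (hFH : ∀ v : x.ballSet r, H (f v) = F v) : ∑' v, H v = ∑' v, F v := by
  rw [← tsum_subtype_eq_of_support_subset hF, ← tsum_subtype_eq_of_support_subset hH,
    ← f.toEquiv.tsum_eq]
  exact tsum_congr hFH

/-- The step probabilities involve only degrees of earlier positions, which lie at distance less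
than r from the root, where the ball shows the full degree. -/
theorem walkProb_eq_of_ballIso {r : ℕ} {x y : RootedGraph}
    (f : x.graph.induce (x.ballSet r) ≃g y.graph.induce (y.ballSet r))
    (hf : f ⟨x.root, x.root_mem_ballSet r⟩ = ⟨y.root, y.root_mem_ballSet r⟩)
    {m : ℕ} (hm : m < r) (v : x.ballSet r) :
    walkProb (backtrackingStep y.graph) y.root m (f v)
      = walkProb (backtrackingStep x.graph) x.root m v := by
  induction m generalizing v with
  | zero =>
    have h : (f v : y.V) = y.root ↔ (v : x.V) = x.root := by
      constructor
      · intro h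
        have h1 : f v = f ⟨x.root, x.root_mem_ballSet r⟩ := by rw [hf]; exact Subtype.ext h
        exact congrArg Subtype.val (f.injective h1)
      · intro h
        have h1 : v = ⟨x.root, x.root_mem_ballSet r⟩ := Subtype.ext h
        rw [h1, hf]
    simp only [walkProb]
    by_cases hv : (v : x.V) = x.root
    · rw [if_pos hv, if_pos (h.mpr hv)]
    · rw [if_neg hv, if_neg (mt h.mp hv)]
  | succ m ih =>
    simp only [walkProb]
    refine tsum_eq_of_ballIso f ?_ ?_ fun i => ?_
    · intro i hi
      exact (x.dist_le_of_walkProb_ne_zero (left_ne_zero_of_mul hi)).trans (by omega)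
    · intro i hi
      exact (y.dist_le_of_walkProb_ne_zero (left_ne_zero_of_mul hi)).trans (by omega)
    · rw [ih (by omega)]
      by_cases h0 : walkProb (backtrackingStep x.graph) x.root m i = 0
      · rw [h0, zero_mul, zero_mul]
      · have hi : x.graph.dist x.root i < r := (x.dist_le_of_walkProb_ne_zero h0).trans_lt (by omega)
        have hadj : y.graph.Adj (f i) (f v) ↔ x.graph.Adj i v := f.map_rel_iff
        simp only [backtrackingStep, deg_eq_of_ballIso f hf i hi]
        by_cases hiv : x.graph.Adj i v
        · rw [if_pos hiv, if_pos (hadj.mpr hiv)]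
        · rw [if_neg hiv, if_neg (mt hadj.mp hiv)]

/-- One level beyond k is needed to see the degree of the position after k steps. -/
theorem backtrackingBias_eq_of_ballIso {k : ℕ} {x y : RootedGraph} (h : BallIso (k + 1) x y) :
    backtrackingBias x.graph x.root k = backtrackingBias y.graph y.root k := by
  obtain ⟨f, hf⟩ := h
  have hroot : deg y.graph y.root = deg x.graph x.root := by
    have h := deg_eq_of_ballIso f hf ⟨x.root, x.root_mem_ballSet _⟩ (by simp)
    rwa [hf] at h
  rw [backtrackingBias, levelBias, backtrackingBias, levelBias, hroot]
  congr 1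
  refine (tsum_eq_of_ballIso f ?_ ?_ fun i => ?_).symm
  · intro i hi
    exact (x.dist_le_of_walkProb_ne_zero (left_ne_zero_of_mul hi)).trans (by omega)
  · intro i hi
    exact (y.dist_le_of_walkProb_ne_zero (left_ne_zero_of_mul hi)).trans (by omega)
  · rw [walkProb_eq_of_ballIso f hf (Nat.lt_succ_self k)]
    by_cases h0 : walkProb (backtrackingStep x.graph) x.root k i = 0
    · rw [h0, zero_mul, zero_mul]
    · rw [deg_eq_of_ballIso f hf i ((x.dist_le_of_walkProb_ne_zero h0).trans_lt (by omega))]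

theorem continuous_backtrackingBias (k : ℕ) :
    Continuous fun x : RootedGraph => backtrackingBias x.graph x.root k :=
  continuous_of_ballIso (k + 1) fun _ _ h => backtrackingBias_eq_of_ballIso h

/-- The number of edges from the root to vertices of degree `b`, if the root has degree `a`. -/
noncomputable def edgeCount (a b : ℕ) (x : RootedGraph) : ℝ :=
  if deg x.graph x.root = a then ({j | x.graph.Adj x.root j ∧ deg x.graph j = b}.ncard : ℝ) else 0

theorem continuous_edgeCount (a b : ℕ) : Continuous (edgeCount a b) := by
  -- Radius 2 shows the degrees of the neighbours of the root.
  refine continuous_of_ballIso 2 fun x y ⟨f, hf⟩ => ?_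
  have hroot := deg_eq_of_ballIso f hf ⟨x.root, x.root_mem_ballSet _⟩ (by simp)
  have hn := ncard_adj_eq_of_ballIso f hf ⟨x.root, x.root_mem_ballSet _⟩ (by simp)
    (A := fun j => deg x.graph j = b) (B := fun j => deg y.graph j = b) fun j hj => by
      have h1 := x.dist_le_succ_of_adj hj
      simp only [SimpleGraph.dist_self, zero_add] at h1
      rw [deg_eq_of_ballIso f hf j (by omega)]
  rw [hf] at hroot hn
  simp only at hroot hn
  rw [edgeCount, edgeCount, hroot, hn]

/-- Fixing the degree of the root is what makes the edge count bounded, and so a legitimate test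
function for local convergence. -/
theorem norm_edgeCount_le (a b : ℕ) (x : RootedGraph) : ‖edgeCount a b x‖ ≤ a := by
  unfold edgeCount
  split_ifs with h
  · rw [Real.norm_natCast, ← h]
    exact_mod_cast Set.ncard_le_ncard (s := {j | x.graph.Adj x.root j ∧ deg x.graph j = b})
      (t := x.graph.neighborSet x.root) (fun j hj => hj.1) (x.locallyFinite x.root)
  · simp

/-- `edgeCount` as a bounded continuous function. -/
noncomputable def edgeCountBCF (a b : ℕ) : RootedGraph →ᵇ ℝ :=
  .ofNormedAddCommGroup (edgeCount a b) (continuous_edgeCount a b) a (norm_edgeCount_le a b)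

end RootedGraph

theorem deg_toSimpleGraph {V : Type} {G : SimpleGraph V} (C : G.ConnectedComponent) (w : C) :
    deg C.toSimpleGraph w = deg G w := by
  unfold deg
  refine Set.ncard_congr (fun j _ => (j : V)) (fun j hj => hj) (fun i j _ _ h => Subtype.ext h) ?_
  intro j hj
  exact ⟨⟨j, C.mem_supp_of_adj_mem_supp w.2 hj⟩, hj, rfl⟩

theorem edgeCount_rootedComponent {V : Type} {G : SimpleGraph V}
    (hG : ∀ v, (G.neighborSet v).Finite) (a b : ℕ) (v : V) :
    RootedGraph.edgeCount a b (rootedComponent G v)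
      = if deg G v = a then ({j | G.Adj v j ∧ deg G j = b}.ncard : ℝ) else 0 := by
  have hfin : ∀ w, ((G.connectedComponentMk v).toSimpleGraph.neighborSet w).Finite := fun w =>
    ((hG w).preimage Subtype.val_injective.injOn).subset fun j hj => hj
  rw [rootedComponent, dif_pos hfin, RootedGraph.edgeCount]
  simp only [deg_toSimpleGraph]
  congr 2
  refine Set.ncard_congr (fun j _ => (j : V)) (fun j hj => hj) (fun i j _ _ h => Subtype.ext h) ?_
  intro j hj
  exact ⟨⟨j, (G.connectedComponentMk v).mem_supp_of_adj_mem_supp rfl hj.1⟩, hj, rfl⟩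

/-- Double counting: both sides count ordered adjacent pairs with prescribed degrees, and reversing
a pair exchanges the two counts. -/
theorem sum_edgeCount_rootedComponent_comm {n : ℕ} (G : SimpleGraph (Fin n)) (a b : ℕ) :
    ∑ i, RootedGraph.edgeCount a b (rootedComponent G i)
      = ∑ i, RootedGraph.edgeCount b a (rootedComponent G i) := by
  classical
  have h : ∀ a b : ℕ, ∀ i, RootedGraph.edgeCount a b (rootedComponent G i)
      = ∑ j, if G.Adj i j ∧ deg G i = a ∧ deg G j = b then (1 : ℝ) else 0 := by
    intro a b i
    rw [edgeCount_rootedComponent fun _ => Set.toFinite _]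
    split_ifs with hi
    · rw [← sum_ite_one_eq_ncard]
      simp [hi]
    · simp [hi]
  simp_rw [h]
  rw [Finset.sum_comm]
  refine Finset.sum_congr rfl fun i _ => Finset.sum_congr rfl fun j _ => if_congr ?_ rfl rfl
  rw [G.adj_comm]
  tauto

/-! ### Backtracking exploration -/

theorem backtracking_convergence {Ω : Type*} [MeasurableSpace Ω] (P : Measure Ω)
    [IsProbabilityMeasure P] (X : Ω → RootedGraph) (hX : Measurable X)
    (hfin : ∀ᵐ ω ∂P, Finite (X ω).V) (hbip : ∀ᵐ ω ∂P, ¬ (X ω).graph.IsBipartite) :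
    (∀ᵐ ω ∂P, Tendsto (fun k => backtrackingBias (X ω).graph (X ω).root k) atTop
      (𝓝 (stationaryBias (X ω).graph (X ω).root))) ∧
    TendstoInDistribution (fun k ω => backtrackingBias (X ω).graph (X ω).root k) atTop
      (fun ω => stationaryBias (X ω).graph (X ω).root) (fun _ => P) P := by
  have hlim : ∀ᵐ ω ∂P, Tendsto (fun k => backtrackingBias (X ω).graph (X ω).root k) atTop
      (𝓝 (stationaryBias (X ω).graph (X ω).root)) := by
    filter_upwards [hfin, hbip] with ω h1 h2
    exact tendsto_backtrackingBias (X ω).connected h2 _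
  have hmeas : ∀ k, AEMeasurable (fun ω => backtrackingBias (X ω).graph (X ω).root k) P := fun k =>
    ((RootedGraph.continuous_backtrackingBias k).measurable.comp hX).aemeasurable
  exact ⟨hlim, tendstoInDistribution_of_ae_tendsto hmeas
    (aemeasurable_of_tendsto_metrizable_ae atTop hmeas hlim) hlim⟩

/-! ### Rooted trees -/

section Tree

variable {V : Type} {G : SimpleGraph V} {o : V}

theorem isOffspring_or_of_adj (hG : G.IsTree) {i j : V} (h : G.Adj i j) :
    IsOffspring G o i j ∨ IsOffspring G o j i :=
  (hG.dist_eq_dist_add_one_of_adj o h).symm.imp (fun hd => ⟨h, hd⟩) fun hd => ⟨h.symm, hd⟩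

theorem IsOffspring.ne_root {i j : V} (h : IsOffspring G o i j) : j ≠ o := by
  rintro rfl
  have := h.2
  simp at this

/-- A geodesic from the root to a parent extends to a geodesic to the child. Paths in a tree are
unique, so the parent is the penultimate vertex of that path. -/
theorem IsOffspring.parent_unique (hG : G.IsTree) {i i' j : V} (h : IsOffspring G o i j)
    (h' : IsOffspring G o i' j) : i = i' := by
  have key : ∀ {i}, IsOffspring G o i j → ∃ p : G.Walk o j, p.IsPath ∧ p.penultimate = i := by
    intro i h
    obtain ⟨p, hp⟩ := hG.connected.exists_walk_length_eq_dist o i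
    refine ⟨p.concat h.1, SimpleGraph.Walk.isPath_of_length_eq_dist _ ?_, by simp⟩
    rw [SimpleGraph.Walk.length_concat, hp, h.2]
  obtain ⟨p, hp, rfl⟩ := key h
  obtain ⟨q, hq, rfl⟩ := key h'
  have := (hG.isAcyclic.subsingleton_path o j).elim ⟨p, hp⟩ ⟨q, hq⟩
  rw [show p = q from congrArg Subtype.val this]

theorem exists_parent (hG : G.Connected) {j : V} (hj : j ≠ o) : ∃ i, IsOffspring G o i j := by
  obtain ⟨p, hp⟩ := hG.exists_walk_length_eq_dist j o
  cases p with
  | nil => exact absurd rfl hj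
  | @cons _ u _ hadj q =>
    refine ⟨u, hadj.symm, ?_⟩
    have h1 : G.dist u o ≤ q.length := SimpleGraph.dist_le q
    have h2 := hG.dist_triangle (u := o) (v := u) (w := j)
    have h3 : G.dist u j = 1 := SimpleGraph.dist_eq_one_iff_adj.mpr hadj.symm
    rw [SimpleGraph.Walk.length_cons, G.dist_comm] at hp
    rw [G.dist_comm] at h1
    omega

theorem isOffspring_root_iff {j : V} : IsOffspring G o o j ↔ G.Adj o j :=
  ⟨fun h => h.1, fun h => ⟨h, by rw [SimpleGraph.dist_eq_one_iff_adj.mpr h, SimpleGraph.dist_self]⟩⟩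

theorem offspring_root : offspring G o o = deg G o := by
  simp only [offspring, isOffspring_root_iff]
  rfl

theorem deg_eq_offspring_add_one (hG : G.IsTree) {j : V} (hfin : (G.neighborSet j).Finite)
    (hj : j ≠ o) : deg G j = offspring G o j + 1 := by
  obtain ⟨i, hi⟩ := exists_parent hG.connected hj
  have h1 : G.neighborSet j = insert i {l | IsOffspring G o j l} := by
    ext l
    simp only [SimpleGraph.mem_neighborSet, Set.mem_insert_iff, Set.mem_ofPred_eq]
    constructor
    · intro h
      exact (isOffspring_or_of_adj hG h).symm.imp (fun h' => h'.parent_unique hG hi) id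
    · rintro (rfl | h)
      · exact hi.1.symm
      · exact h.1
  have h2 : i ∉ {l | IsOffspring G o j l} := fun h => by
    have := h.2
    have := hi.2
    omega
  rw [deg, h1, Set.ncard_insert_of_notMem h2 (hfin.subset fun l hl => hl.1)]
  rfl

theorem nonBacktrackingStep_nonneg (i j : V) : 0 ≤ nonBacktrackingStep G o i j := by
  unfold nonBacktrackingStep
  split_ifs <;> positivity

theorem nonBacktrackingStep_ne_zero {i j : V} (h : nonBacktrackingStep G o i j ≠ 0) :
    IsOffspring G o i j := by
  by_contra h'
  exact h (if_neg h')

theorem nonBacktrackingStep_support_finite (hfin : ∀ v, (G.neighborSet v).Finite) (i : V) :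
    (Function.support (nonBacktrackingStep G o i)).Finite :=
  (hfin i).subset fun _ hj => (nonBacktrackingStep_ne_zero hj).1

theorem tsum_nonBacktrackingStep (hfin : ∀ v, (G.neighborSet v).Finite) {i : V}
    (hi : 1 ≤ offspring G o i) : ∑' j, nonBacktrackingStep G o i j = 1 := by
  have hf : {j | IsOffspring G o i j}.Finite := (hfin i).subset fun j hj => hj.1
  rw [tsum_eq_sum (s := hf.toFinset) fun j hj => by
    by_contra hne
    exact hj (hf.mem_toFinset.mpr (nonBacktrackingStep_ne_zero hne))]
  rw [Finset.sum_congr rfl fun j hj => show nonBacktrackingStep G o i j = 1 / (offspring G o i : ℝ)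
    from if_pos (hf.mem_toFinset.mp hj)]
  rw [Finset.sum_const, nsmul_eq_mul, ← Set.ncard_eq_toFinset_card _ hf]
  exact mul_one_div_cancel (Nat.cast_ne_zero.mpr (by omega : offspring G o i ≠ 0))

theorem walkProb_succ_root (k : ℕ) : walkProb (nonBacktrackingStep G o) o (k + 1) o = 0 := by
  by_contra h
  obtain ⟨i, _, hi⟩ := exists_of_walkProb_succ_ne_zero h
  exact (nonBacktrackingStep_ne_zero hi).ne_root rfl

/-- A vertex receives mass only from its single parent, which splits its own mass among at least two
offspring. -/
theorem walkProb_le_half_pow (hG : G.IsTree) (h2 : ∀ i, 2 ≤ offspring G o i) (k : ℕ) (j : V) :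
    walkProb (nonBacktrackingStep G o) o k j ≤ (1 / 2) ^ k := by
  induction k generalizing j with
  | zero => simp only [walkProb]; split_ifs <;> norm_num
  | succ k ih =>
    simp only [walkProb]
    by_cases hj : ∃ i, IsOffspring G o i j
    · obtain ⟨i, hi⟩ := hj
      rw [tsum_eq_single i fun i' hi' => by
        rw [show nonBacktrackingStep G o i' j = 0 from if_neg fun h => hi' (h.parent_unique hG hi),
          mul_zero], show nonBacktrackingStep G o i j = 1 / (offspring G o i : ℝ) from if_pos hi,
        pow_succ]
      have h3 : (2 : ℝ) ≤ offspring G o i := by exact_mod_cast h2 i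
      exact mul_le_mul (ih i) (one_div_le_one_div_of_le two_pos h3) (by positivity) (by positivity)
    · push Not at hj
      have : ∀ i, walkProb (nonBacktrackingStep G o) o k i * nonBacktrackingStep G o i j = 0 :=
        fun i => by rw [show nonBacktrackingStep G o i j = 0 from if_neg (hj i), mul_zero]
      simp only [this, tsum_zero]
      positivity

end Tree

/-- In a labelling of a tree where every vertex precedes its offspring, the walk reaches `j` from
the vertices labelled below `j`. -/
theorem walkProb_succ_eq_sum_range {G : SimpleGraph ℕ} (hG : G.IsTree)
    (hlt : ∀ i j, IsOffspring G 0 i j → i < j) (k j : ℕ) [∀ i, Decidable (G.Adj i j)] :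
    walkProb (nonBacktrackingStep G 0) 0 (k + 1) j
      = ∑ i ∈ Finset.range j, walkProb (nonBacktrackingStep G 0) 0 k i *
          if G.Adj i j then 1 / (offspring G 0 i : ℝ) else 0 := by
  simp only [walkProb]
  rw [tsum_eq_sum (s := Finset.range j)]
  · refine Finset.sum_congr rfl fun i hi => ?_
    congr 1
    unfold nonBacktrackingStep
    by_cases h : G.Adj i j
    · rw [if_pos h, if_pos]
      exact (isOffspring_or_of_adj hG h).resolve_right fun h' =>
        (hlt _ _ h').not_gt (Finset.mem_range.mp hi)
    · rw [if_neg h, if_neg fun h' => h h'.1]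
  · intro i hi
    by_contra hne
    exact hi (Finset.mem_range.mpr (hlt _ _ (nonBacktrackingStep_ne_zero (right_ne_zero_of_mul hne))))

/-! ### Sequences of integer valued random variables and functions of their initial segments -/

section Determined

variable {Ω : Type*} [MeasurableSpace Ω] {P : Measure Ω} {d : ℕ → Ω → ℕ}

/-- The random variable `f` is almost surely a function of `d 0, …, d (j - 1)`. -/
def DeterminedBelow {β : Type*} (P : Measure Ω) (d : ℕ → Ω → ℕ) (j : ℕ) (f : Ω → β) : Prop :=
  ∃ g : (Fin j → ℕ) → β, f =ᵐ[P] fun ω => g fun l => d l ω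

namespace DeterminedBelow

theorem mono {β : Type*} {i j : ℕ} (hij : i ≤ j) {f : Ω → β} (hf : DeterminedBelow P d i f) :
    DeterminedBelow P d j f := by
  obtain ⟨g, hg⟩ := hf
  exact ⟨fun x => g fun l => x (Fin.castLE hij l), hg⟩

theorem congr {β : Type*} {j : ℕ} {f f' : Ω → β} (hf : DeterminedBelow P d j f)
    (h : f =ᵐ[P] f') : DeterminedBelow P d j f' := by
  obtain ⟨g, hg⟩ := hf
  exact ⟨g, h.symm.trans hg⟩

theorem const {β : Type*} (j : ℕ) (b : β) : DeterminedBelow P d j fun _ => b :=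
  ⟨fun _ => b, ae_eq_rfl⟩

theorem of_lt {l j : ℕ} (h : l < j) : DeterminedBelow P d j (d l) :=
  ⟨fun x => x ⟨l, h⟩, ae_eq_rfl⟩

theorem map₂ {β γ δ : Type*} {j : ℕ} {f : Ω → β} {f' : Ω → γ} (hf : DeterminedBelow P d j f)
    (hf' : DeterminedBelow P d j f') (φ : β → γ → δ) :
    DeterminedBelow P d j fun ω => φ (f ω) (f' ω) := by
  obtain ⟨g, hg⟩ := hf
  obtain ⟨g', hg'⟩ := hf'
  refine ⟨fun x => φ (g x) (g' x), ?_⟩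
  filter_upwards [hg, hg'] with ω h h'
  rw [h, h']

theorem map {β γ : Type*} {j : ℕ} {f : Ω → β} (hf : DeterminedBelow P d j f) (φ : β → γ) :
    DeterminedBelow P d j fun ω => φ (f ω) :=
  hf.map₂ (const j ()) fun b _ => φ b

theorem finset_sum {ι : Type*} {j : ℕ} {s : Finset ι} {f : ι → Ω → ℝ}
    (hf : ∀ i ∈ s, DeterminedBelow P d j (f i)) :
    DeterminedBelow P d j fun ω => ∑ i ∈ s, f i ω := by
  classical
  induction s using Finset.induction_on with
  | empty => simpa using const j (0 : ℝ)
  | insert i s hi ih =>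
    simp_rw [Finset.sum_insert hi]
    exact (hf i (Finset.mem_insert_self i s)).map₂
      (ih fun l hl => hf l (Finset.mem_insert_of_mem hl)) (· + ·)

theorem aemeasurable {β : Type*} [MeasurableSpace β] {j : ℕ} {f : Ω → β}
    (hf : DeterminedBelow P d j f) (hd : ∀ l, AEMeasurable (d l) P) : AEMeasurable f P := by
  obtain ⟨g, hg⟩ := hf
  exact ((Measurable.of_discrete (f := g)).comp_aemeasurable
    (aemeasurable_pi_lambda _ fun l => hd l)).congr hg.symm

theorem indepFun {β γ : Type*} [MeasurableSpace β] [MeasurableSpace γ] {j : ℕ} {f : Ω → β}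
    (hf : DeterminedBelow P d j f) (hd : IndepFun (fun ω (l : Fin j) => d l ω) (d j) P)
    (φ : ℕ → γ) : IndepFun f (fun ω => φ (d j ω)) P := by
  obtain ⟨g, hg⟩ := hf
  exact (hd.comp (Measurable.of_discrete (f := g)) (Measurable.of_discrete (f := φ))).congr
    hg.symm ae_eq_rfl

end DeterminedBelow

/-- If `d 0` is independent of the independent sequence `d 1, d 2, …`, then the whole sequence is
independent. -/
theorem iIndepFun_of_head_tail (h0 : IndepFun (d 0) (fun ω (i : ℕ) => d (i + 1) ω) P)
    (h : iIndepFun (fun i => d (i + 1)) P) : iIndepFun d P := by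
  classical
  have := h.isProbabilityMeasure
  rw [iIndepFun_iff_measure_inter_preimage_eq_mul]
  intro S B hB
  set S' := S.preimage Nat.succ Nat.succ_injective.injOn with hS'
  -- The whole space stands in as the condition on `d 0` when the index 0 is absent, so both cases
  -- factor alike.
  set A : Set ℕ := if 0 ∈ S then B 0 else Set.univ with hA
  set C : Set (ℕ → ℕ) := ⋂ i ∈ S', (fun y => y i) ⁻¹' B (i + 1) with hC
  have hCm : MeasurableSet C := S'.measurableSet_biInter fun i _ =>
    measurable_pi_apply i (MeasurableSet.of_discrete (s := B (i + 1)))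
  have hset : (⋂ i ∈ S, d i ⁻¹' B i) = d 0 ⁻¹' A ∩ (fun ω (i : ℕ) => d (i + 1) ω) ⁻¹' C := by
    ext ω
    simp only [Set.mem_iInter, Set.mem_preimage, Set.mem_inter_iff, hC, hA, hS',
      Finset.mem_preimage]
    constructor
    · intro hω
      refine ⟨?_, fun i hi => hω _ hi⟩
      split_ifs with h0
      · exact hω 0 h0
      · trivial
    · rintro ⟨h1, h2⟩ i hi
      cases i with
      | zero => rwa [if_pos hi] at h1
      | succ i => exact h2 i hi
  have hprod : ∏ i ∈ S, P (d i ⁻¹' B i)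
      = P (d 0 ⁻¹' A) * ∏ i ∈ S', P (d (i + 1) ⁻¹' B (i + 1)) := by
    have himg : ∏ i ∈ S', P (d (i + 1) ⁻¹' B (i + 1)) = ∏ i ∈ S.erase 0, P (d i ⁻¹' B i) := by
      refine Finset.prod_nbij Nat.succ ?_ Nat.succ_injective.injOn ?_ fun _ _ => rfl
      · intro i hi
        exact Finset.mem_erase.mpr ⟨Nat.succ_ne_zero i, Finset.mem_preimage.mp hi⟩
      · intro i hi
        obtain ⟨hi0, hiS⟩ := Finset.mem_erase.mp hi
        obtain ⟨l, rfl⟩ := Nat.exists_eq_succ_of_ne_zero hi0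
        exact ⟨l, Finset.mem_preimage.mpr hiS, rfl⟩
    rw [himg]
    by_cases h0 : 0 ∈ S
    · rw [hA, if_pos h0, Finset.mul_prod_erase S (fun i => P (d i ⁻¹' B i)) h0]
    · rw [hA, if_neg h0, Finset.erase_eq_of_notMem h0, Set.preimage_univ, measure_univ, one_mul]
  rw [hset, hprod, h0.measure_inter_preimage_eq_mul _ _ MeasurableSet.of_discrete hCm,
    ← h.measure_inter_preimage_eq_mul S' (sets := fun i => B (i + 1))
      fun i _ => MeasurableSet.of_discrete]
  congr 2
  ext ω
  simp [hC]

theorem iIndepFun.indepFun_initial (h : iIndepFun d P) (hd : ∀ l, AEMeasurable (d l) P) (j : ℕ) :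
    IndepFun (fun ω (l : Fin j) => d l ω) (d j) P := by
  have h1 := h.indepFun_finset₀ (Finset.range j) {j} (by simp) hd
  have h2 : Measurable fun (x : Finset.range j → ℕ) (l : Fin j) => x ⟨l, Finset.mem_range.mpr l.2⟩ :=
    Measurable.of_discrete
  have h3 : Measurable fun x : ({j} : Finset ℕ) → ℕ => x ⟨j, Finset.mem_singleton_self j⟩ :=
    Measurable.of_discrete
  exact h1.comp h2 h3

/-- Second moment of a martingale transform of centred independent variables. -/
theorem memLp_two_and_integral_sq_sum [IsProbabilityMeasure P] (hd : ∀ l, AEMeasurable (d l) P)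
    (hind : ∀ j, IndepFun (fun ω (l : Fin j) => d l ω) (d j) P) {W : ℕ → Ω → ℝ}
    (hW : ∀ j, DeterminedBelow P d j (W j)) (hW1 : ∀ j, ∀ᵐ ω ∂P, |W j ω| ≤ 1) {φ : ℕ → ℝ} {s : ℝ}
    (hL2 : ∀ j, MemLp (fun ω => φ (d (j + 1) ω)) 2 P)
    (hmean : ∀ j, ∫ ω, φ (d (j + 1) ω) ∂P = 0)
    (hvar : ∀ j, ∫ ω, φ (d (j + 1) ω) ^ 2 ∂P = s) (N : ℕ) :
    MemLp (fun ω => ∑ j ∈ Finset.range N, W (j + 1) ω * φ (d (j + 1) ω)) 2 P ∧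
    ∫ ω, (∑ j ∈ Finset.range N, W (j + 1) ω * φ (d (j + 1) ω)) ^ 2 ∂P
      = s * ∫ ω, ∑ j ∈ Finset.range N, W (j + 1) ω ^ 2 ∂P := by
  have hWm : ∀ j, AEMeasurable (W j) P := fun j => (hW j).aemeasurable hd
  have hterm : ∀ j, MemLp (fun ω => W (j + 1) ω * φ (d (j + 1) ω)) 2 P := fun j => by
    refine (hL2 j).of_le_mul (c := 1)
      ((hWm _).aestronglyMeasurable.mul (hL2 j).aestronglyMeasurable) ?_
    filter_upwards [hW1 (j + 1)] with ω hω
    rw [norm_mul]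
    exact mul_le_mul_of_nonneg_right hω (norm_nonneg _)
  have hWsq : ∀ j, Integrable (fun ω => W j ω ^ 2) P := fun j => by
    refine Integrable.of_bound ((hWm j).pow_const 2).aestronglyMeasurable 1 ?_
    filter_upwards [hW1 j] with ω hω
    rw [norm_pow]
    exact pow_le_one₀ (norm_nonneg _) hω
  induction N with
  | zero => simp
  | succ N ih =>
    obtain ⟨ih1, ih2⟩ := ih
    set S : Ω → ℝ := fun ω => ∑ j ∈ Finset.range N, W (j + 1) ω * φ (d (j + 1) ω) with hS
    set Y : Ω → ℝ := fun ω => φ (d (N + 1) ω) with hY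
    have hSdet : DeterminedBelow P d (N + 1) S := DeterminedBelow.finset_sum fun j hj => by
      have hj' := Finset.mem_range.mp hj
      exact ((hW (j + 1)).mono (by omega)).map₂
        ((DeterminedBelow.of_lt (by omega : j + 1 < N + 1)).map φ) (· * ·)
    simp only [Finset.sum_range_succ]
    refine ⟨ih1.add (hterm N), ?_⟩
    -- The factor `S * W (N + 1)` is a function of `d 0, …, d N`, hence independent of the centred
    -- variable `Y`.
    have hcross : ∫ ω, S ω * W (N + 1) ω * Y ω ∂P = 0 := by
      have hdet : DeterminedBelow P d (N + 1) fun ω => S ω * W (N + 1) ω :=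
        hSdet.map₂ (hW (N + 1)) (· * ·)
      rw [(hdet.indepFun (hind (N + 1)) φ).integral_fun_mul_eq_mul_integral
        (hdet.aemeasurable hd).aestronglyMeasurable (hL2 N).aestronglyMeasurable, hmean, mul_zero]
    have hdiag : ∫ ω, W (N + 1) ω ^ 2 * Y ω ^ 2 ∂P = s * ∫ ω, W (N + 1) ω ^ 2 ∂P := by
      have hdet : DeterminedBelow P d (N + 1) fun ω => W (N + 1) ω ^ 2 := (hW (N + 1)).map (· ^ 2)
      rw [(hdet.indepFun (hind (N + 1)) fun n => φ n ^ 2).integral_fun_mul_eq_mul_integral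
        (hdet.aemeasurable hd).aestronglyMeasurable
        ((hL2 N).aestronglyMeasurable.pow 2), hvar, mul_comm]
    have hi1 : Integrable (fun ω => S ω ^ 2) P := ih1.integrable_sq
    have hi2 : Integrable (fun ω => S ω * W (N + 1) ω * Y ω) P := by
      have := ih1.integrable_mul (hterm N)
      refine this.congr (ae_of_all _ fun ω => ?_)
      simp only [Pi.mul_apply, hS, hY]
      ring
    have hi3 : Integrable (fun ω => W (N + 1) ω ^ 2 * Y ω ^ 2) P := by
      refine (hterm N).integrable_sq.congr (ae_of_all _ fun ω => ?_)
      simp only [hY]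
      ring
    have hexp : ∀ ω, (S ω + W (N + 1) ω * Y ω) ^ 2
        = S ω ^ 2 + 2 * (S ω * W (N + 1) ω * Y ω) + W (N + 1) ω ^ 2 * Y ω ^ 2 := fun ω => by ring
    have hi12 : Integrable (fun ω => S ω ^ 2 + 2 * (S ω * W (N + 1) ω * Y ω)) P :=
      hi1.add (hi2.const_mul 2)
    rw [integral_congr_ae (ae_of_all _ hexp), integral_add hi12 hi3,
      integral_add hi1 (hi2.const_mul 2), integral_const_mul, hcross, hdiag, ih2,
      integral_add (integrable_finsetSum _ fun j _ => hWsq _) (hWsq _)]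
    ring

/-- The martingale transform of centred independent variables by weights `W j` with sum at most `1`
and maximum at most `c` has second moment at most `s * c`. -/
theorem eLpNorm_two_tsum_le [IsProbabilityMeasure P] (hd : ∀ l, AEMeasurable (d l) P)
    (hind : ∀ j, IndepFun (fun ω (l : Fin j) => d l ω) (d j) P) {W : ℕ → Ω → ℝ}
    (hW : ∀ j, DeterminedBelow P d j (W j)) {c : ℝ} (hc : c ≤ 1)
    (hW0 : ∀ᵐ ω ∂P, ∀ j, 0 ≤ W j ω) (hWc : ∀ᵐ ω ∂P, ∀ j, W j ω ≤ c)
    (hWfin : ∀ᵐ ω ∂P, (Function.support fun j => W j ω).Finite)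
    (hWsum : ∀ᵐ ω ∂P, ∑' j, W j ω ≤ 1) {φ : ℕ → ℝ} {s : ℝ}
    (hL2 : ∀ j, MemLp (fun ω => φ (d (j + 1) ω)) 2 P)
    (hmean : ∀ j, ∫ ω, φ (d (j + 1) ω) ∂P = 0)
    (hvar : ∀ j, ∫ ω, φ (d (j + 1) ω) ^ 2 ∂P = s) :
    eLpNorm (fun ω => ∑' j, W (j + 1) ω * φ (d (j + 1) ω)) 2 P
      ≤ ENNReal.ofReal ((s * c) ^ (2⁻¹ : ℝ)) := by
  have hW1 : ∀ j, ∀ᵐ ω ∂P, |W j ω| ≤ 1 := fun j => by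
    filter_upwards [hW0, hWc] with ω h0 h1
    rw [abs_of_nonneg (h0 j)]
    exact (h1 j).trans hc
  have hs : 0 ≤ s := hvar 0 ▸ integral_nonneg fun ω => sq_nonneg _
  have hkey := memLp_two_and_integral_sq_sum hd hind hW hW1 hL2 hmean hvar
  -- The sum of squares is at most the maximum times the sum of the weights.
  have hsumfin : ∀ᵐ ω ∂P, ∀ N, ∑ j ∈ Finset.range N, W (j + 1) ω ^ 2 ≤ c := by
    filter_upwards [hW0, hWc, hWfin, hWsum] with ω h0 h1 h2 h3 N
    have hsm : Summable fun j => W j ω := summable_of_hasFiniteSupport h2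
    have h4 : ∑ j ∈ Finset.range N, W (j + 1) ω ≤ 1 := by
      refine le_trans ?_ h3
      rw [hsm.tsum_eq_zero_add]
      exact (((summable_nat_add_iff 1).mpr hsm).sum_le_tsum _ fun j _ => h0 _).trans
        (le_add_of_nonneg_left (h0 0))
    have hc0 : 0 ≤ c := (h0 0).trans (h1 0)
    calc ∑ j ∈ Finset.range N, W (j + 1) ω ^ 2 ≤ ∑ j ∈ Finset.range N, c * W (j + 1) ω :=
          Finset.sum_le_sum fun j _ => by
            rw [sq]
            exact mul_le_mul_of_nonneg_right (h1 _) (h0 _)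
      _ = c * ∑ j ∈ Finset.range N, W (j + 1) ω := (Finset.mul_sum _ _ _).symm
      _ ≤ c * 1 := mul_le_mul_of_nonneg_left h4 hc0
      _ = c := mul_one c
  -- The bound passes from partial sums to the full sum by Fatou; the partial sums converge because
  -- almost surely only finitely many weights are nonzero.
  refine Lp.eLpNorm_le_of_ae_tendsto (u := atTop)
    (f := fun N ω => ∑ j ∈ Finset.range N, W (j + 1) ω * φ (d (j + 1) ω))
    (Eventually.of_forall fun N => ?_) (fun N => (hkey N).1.aestronglyMeasurable) ?_
  · rw [(hkey N).1.eLpNorm_eq_integral_rpow_norm two_ne_zero ENNReal.ofNat_ne_top]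
    refine ENNReal.ofReal_le_ofReal ?_
    simp only [ENNReal.toReal_ofNat, Real.rpow_two, Real.norm_eq_abs, sq_abs]
    refine Real.rpow_le_rpow (integral_nonneg fun ω => sq_nonneg _) ?_ (by norm_num)
    rw [(hkey N).2]
    refine mul_le_mul_of_nonneg_left ?_ hs
    have hint : ∫ ω, ∑ j ∈ Finset.range N, W (j + 1) ω ^ 2 ∂P ≤ ∫ _, c ∂P := by
      refine integral_mono_of_nonneg (ae_of_all _ fun ω => Finset.sum_nonneg fun j _ => sq_nonneg _)
        (integrable_const c) ?_
      filter_upwards [hsumfin] with ω hω using hω N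
    simpa using hint
  · filter_upwards [hWfin] with ω hω
    have hsm : Summable fun j => W (j + 1) ω * φ (d (j + 1) ω) := by
      refine summable_of_hasFiniteSupport ((hω.preimage (Nat.succ_injective.injOn)).subset ?_)
      intro j hj
      exact left_ne_zero_of_mul hj
    exact hsm.hasSum.tendsto_sum_nat

end Determined

/-! ### Mass transport in the local limit -/

/-- If the two limits differed, then for large n with positive probability both averages would be
within half the gap of their own limits, although they almost surely coincide. -/
theorem LocallyConvergesInProbability.integral_eq {Ωn : ℕ → Type*} [∀ n, MeasurableSpace (Ωn n)]
    {Pn : ∀ n, Measure (Ωn n)} [∀ n, IsProbabilityMeasure (Pn n)]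
    {G : ∀ n, Ωn n → SimpleGraph (Fin n)} {Ω : Type*} [MeasurableSpace Ω] {P : Measure Ω}
    {X : Ω → RootedGraph} (h : LocallyConvergesInProbability Pn G P X) (f g : RootedGraph →ᵇ ℝ)
    (hfg : ∀ᶠ n in atTop, ∀ᵐ ω ∂(Pn n), ∑ i, f (rootedComponent (G n ω) i)
      = ∑ i, g (rootedComponent (G n ω) i)) :
    ∫ ω, f (X ω) ∂P = ∫ ω, g (X ω) ∂P := by
  by_contra hne
  set A := ∫ ω, f (X ω) ∂P
  set B := ∫ ω, g (X ω) ∂P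
  have hε : 0 < |A - B| / 2 := half_pos (abs_pos.mpr (sub_ne_zero.mpr hne))
  have hlim := (h f _ hε).add (h g _ hε)
  rw [add_zero] at hlim
  have hlt := hlim.eventually (gt_mem_nhds one_pos)
  obtain ⟨n, hn, hn'⟩ := (hlt.and hfg).exists
  refine hn.not_ge ?_
  rw [← measure_univ (μ := Pn n)]
  refine (measure_mono_ae ?_).trans (measure_union_le _ _)
  filter_upwards [hn'] with ω hω _
  by_contra hnot
  replace hnot : ω ∉ ({ω | _} ∪ {ω | _} : Set (Ωn n)) := hnot
  simp only [Set.mem_union, Set.mem_ofPred_eq, not_or, not_le] at hnot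
  obtain ⟨h1, h2⟩ := hnot
  rw [hω] at h1
  rw [abs_lt] at h1 h2
  have h3 : |A - B| < |A - B| / 2 + |A - B| / 2 := abs_lt.mpr ⟨by linarith, by linarith⟩
  linarith

theorem indicator_one_congr {α β : Type*} {s : Set α} {t : Set β} {x : α} {y : β}
    (h : x ∈ s ↔ y ∈ t) : s.indicator (1 : α → ℝ≥0∞) x = t.indicator (1 : β → ℝ≥0∞) y := by
  by_cases hx : x ∈ s
  · rw [Set.indicator_of_mem hx, Set.indicator_of_mem (h.mp hx), Pi.one_apply, Pi.one_apply]
  · rw [Set.indicator_of_notMem hx, Set.indicator_of_notMem (mt h.mpr hx)]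

theorem tsum_indicator_one {A : Set ℕ} (hA : A.Finite) :
    ∑' j, A.indicator (1 : ℕ → ℝ≥0∞) j = (A.ncard : ℝ≥0∞) := by
  rw [← tsum_subtype]
  simp only [Pi.one_apply]
  rw [ENNReal.tsum_set_one, ← hA.cast_ncard_eq]
  rfl

theorem aemeasurable_deg {Ω : Type*} [MeasurableSpace Ω] {P : Measure Ω} {T : Ω → SimpleGraph ℕ}
    (hT : Measurable T) {v : ℕ} (hfin : ∀ᵐ ω ∂P, ((T ω).neighborSet v).Finite) :
    AEMeasurable (fun ω => deg (T ω) v) P := by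
  -- The degree is a countable sum of measurable indicators; the floor only brings the value back to
  -- ℕ.
  have h1 : Measurable fun ω =>
      ⌊(∑' j, {ω | (T ω).Adj v j}.indicator (1 : Ω → ℝ≥0∞) ω).toReal⌋₊ := by
    refine (Measurable.tsum fun j => ?_).ennreal_toReal.nat_floor
    exact measurable_one.indicator (measurableSet_setOfPred.mpr
      ((SimpleGraph.measurable_iff_adj.mp hT) v j))
  refine h1.aemeasurable.congr ?_
  filter_upwards [hfin] with ω hω
  have h2 := tsum_indicator_one hω
  have h3 : ∀ j, {ω | (T ω).Adj v j}.indicator (1 : Ω → ℝ≥0∞) ω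
      = ((T ω).neighborSet v).indicator (1 : ℕ → ℝ≥0∞) j := fun j => rfl
  simp only [h3, h2, ENNReal.toReal_natCast, Nat.floor_natCast]
  rfl

/-- A random tree on `ℕ` rooted at `0`, labelled in the order of an exploration, in which the
offspring number of each vertex is independent of those of the vertices with smaller labels, and
the offspring numbers of the vertices other than the root are identically distributed. -/
structure IsExploredTree {Ω : Type*} [MeasurableSpace Ω] (P : Measure Ω)
    (T : Ω → SimpleGraph ℕ) : Prop where
  isTree : ∀ᵐ ω ∂P, (T ω).IsTree
  locallyFinite : ∀ᵐ ω ∂P, ∀ v, ((T ω).neighborSet v).Finite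
  one_le : ∀ᵐ ω ∂P, ∀ v, 1 ≤ offspring (T ω) 0 v
  lt : ∀ᵐ ω ∂P, ∀ i j, IsOffspring (T ω) 0 i j → i < j
  determined : ∀ i j, i < j →
    DeterminedBelow P (fun l ω => offspring (T ω) 0 l) j fun ω => (T ω).Adj i j
  aemeasurable : ∀ l, AEMeasurable (fun ω => offspring (T ω) 0 l) P
  indep : ∀ j, IndepFun (fun ω (l : Fin j) => offspring (T ω) 0 l)
    (fun ω => offspring (T ω) 0 j) P
  identDistrib : ∀ i, IdentDistrib (fun ω => offspring (T ω) 0 (i + 1))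
    (fun ω => offspring (T ω) 0 1) P P

namespace IsExploredTree

variable {Ω : Type*} [MeasurableSpace Ω] {P : Measure Ω} {T : Ω → SimpleGraph ℕ}

/-- The first event is a function of the offspring numbers below j, hence independent of the
offspring number of j. For j = 0 both sides vanish, as there are no loops. -/
theorem measure_adj_inter (h : IsExploredTree P T) (a b j : ℕ) :
    P ({ω | offspring (T ω) 0 0 = a ∧ (T ω).Adj 0 j} ∩ {ω | deg (T ω) j = b})
      = P {ω | offspring (T ω) 0 0 = a ∧ (T ω).Adj 0 j} * P {ω | offspring (T ω) 0 1 + 1 = b} := by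
  cases j with
  | zero => simp
  | succ j =>
    have hF : P ({ω | offspring (T ω) 0 0 = a ∧ (T ω).Adj 0 (j + 1)} ∩ {ω | deg (T ω) (j + 1) = b})
        = P ({ω | offspring (T ω) 0 0 = a ∧ (T ω).Adj 0 (j + 1)} ∩
          {ω | offspring (T ω) 0 (j + 1) + 1 = b}) := by
      refine measure_congr ?_
      filter_upwards [h.isTree, h.locallyFinite] with ω h1 h2
      refine propext (and_congr_right fun _ => ?_)
      change deg (T ω) (j + 1) = b ↔ offspring (T ω) 0 (j + 1) + 1 = b
      rw [deg_eq_offspring_add_one (o := 0) h1 (h2 _) (Nat.succ_ne_zero j)]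
    have hE : DeterminedBelow P (fun l ω => offspring (T ω) 0 l) (j + 1)
        fun ω => offspring (T ω) 0 0 = a ∧ (T ω).Adj 0 (j + 1) :=
      ((DeterminedBelow.of_lt (Nat.succ_pos j)).map (· = a)).map₂
        (h.determined 0 (j + 1) (Nat.succ_pos j)) (· ∧ ·)
    have hid : P {ω | offspring (T ω) 0 (j + 1) + 1 = b} = P {ω | offspring (T ω) 0 1 + 1 = b} :=
      (h.identDistrib j).measure_mem_eq (s := {n | n + 1 = b}) MeasurableSet.of_discrete
    rw [hF, ← hid]
    have hm := (hE.indepFun (h.indep (j + 1)) id).measure_inter_preimage_eq_mul {True}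
      {n | n + 1 = b} MeasurableSet.of_discrete MeasurableSet.of_discrete
    have hpre : (fun ω => offspring (T ω) 0 0 = a ∧ (T ω).Adj 0 (j + 1)) ⁻¹' {True}
        = {ω | offspring (T ω) 0 0 = a ∧ (T ω).Adj 0 (j + 1)} := by
      ext ω
      simp
    rw [hpre] at hm
    exact hm

/-- Sum over the label j of the neighbour: the events `E j` have total probability a P(d_φ = a), and
each contributes the same factor P(d_1 + 1 = b). Working in `ℝ≥0∞` allows the exchange of sum and
integral. -/
theorem integral_edgeCount (h : IsExploredTree P T) (hT : Measurable T) (a b : ℕ) :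
    ∫ ω, RootedGraph.edgeCount a b (rootedComponent (T ω) 0) ∂P
      = ((a : ℝ≥0∞) * P {ω | offspring (T ω) 0 0 = a}
          * P {ω | offspring (T ω) 0 1 + 1 = b}).toReal := by
  set E : ℕ → Set Ω := fun j => {ω | offspring (T ω) 0 0 = a ∧ (T ω).Adj 0 j} with hE
  set F : ℕ → Set Ω := fun j => {ω | deg (T ω) j = b} with hF
  have hd0 : NullMeasurableSet {ω | offspring (T ω) 0 0 = a} P :=
    (h.aemeasurable 0).nullMeasurableSet_preimage (s := {a}) MeasurableSet.of_discrete
  have hEm : ∀ j, NullMeasurableSet (E j) P := fun j =>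
    hd0.inter (measurableSet_setOfPred.mpr
      ((SimpleGraph.measurable_iff_adj.mp hT) 0 j)).nullMeasurableSet
  have hFm : ∀ j, NullMeasurableSet (F j) P := fun j =>
    (aemeasurable_deg hT (h.locallyFinite.mono fun ω hω => hω j)).nullMeasurableSet_preimage
      (s := {b}) MeasurableSet.of_discrete
  have hind : ∀ A : ℕ → Set Ω, (∀ j, NullMeasurableSet (A j) P) →
      ∀ j, AEMeasurable ((A j).indicator (1 : Ω → ℝ≥0∞)) P := fun A hA j =>
    aemeasurable_const.indicator₀ (hA j)
  have hcount : ∀ᵐ ω ∂P, RootedGraph.edgeCount a b (rootedComponent (T ω) 0)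
      = (∑' j, (E j ∩ F j).indicator (1 : Ω → ℝ≥0∞) ω).toReal := by
    filter_upwards [h.locallyFinite] with ω hω
    rw [edgeCount_rootedComponent hω, ← offspring_root]
    split_ifs with ha
    · have hset : ∀ j, (E j ∩ F j).indicator (1 : Ω → ℝ≥0∞) ω
          = {j | (T ω).Adj 0 j ∧ deg (T ω) j = b}.indicator (1 : ℕ → ℝ≥0∞) j := fun j =>
        indicator_one_congr ⟨fun hj => ⟨hj.1.2, hj.2⟩, fun hj => ⟨⟨ha, hj.1⟩, hj.2⟩⟩
      simp only [hset]
      rw [tsum_indicator_one ((hω 0).subset fun j hj => hj.1), ENNReal.toReal_natCast]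
    · have hset : ∀ j, (E j ∩ F j).indicator (1 : Ω → ℝ≥0∞) ω = 0 := fun j =>
        Set.indicator_of_notMem (fun hj => ha hj.1.1) _
      simp [hset]
  have hroot : ∀ᵐ ω ∂P, ∑' j, (E j).indicator (1 : Ω → ℝ≥0∞) ω
      = {ω | offspring (T ω) 0 0 = a}.indicator (fun _ => (a : ℝ≥0∞)) ω := by
    filter_upwards [h.locallyFinite] with ω hω
    by_cases ha : offspring (T ω) 0 0 = a
    · have hset : ∀ j, (E j).indicator (1 : Ω → ℝ≥0∞) ω
          = ((T ω).neighborSet 0).indicator (1 : ℕ → ℝ≥0∞) j := fun j =>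
        indicator_one_congr ⟨fun hj => hj.2, fun hj => ⟨ha, hj⟩⟩
      simp only [hset]
      rw [tsum_indicator_one (hω 0), Set.indicator_of_mem (by exact ha)]
      rw [← ha, offspring_root]
      rfl
    · have hset : ∀ j, (E j).indicator (1 : Ω → ℝ≥0∞) ω = 0 := fun j =>
        Set.indicator_of_notMem (fun hj => ha hj.1) _
      rw [Set.indicator_of_notMem (by exact ha)]
      simp [hset]
  have hsum : ∑' j, P (E j) = (a : ℝ≥0∞) * P {ω | offspring (T ω) 0 0 = a} := by
    rw [← lintegral_indicator_const₀ hd0, ← lintegral_congr_ae hroot, lintegral_tsum (hind E hEm)]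
    exact tsum_congr fun j => (lintegral_indicator_one₀ (hEm j)).symm
  have hEF : ∫⁻ ω, ∑' j, (E j ∩ F j).indicator (1 : Ω → ℝ≥0∞) ω ∂P
      = (a : ℝ≥0∞) * P {ω | offspring (T ω) 0 0 = a} * P {ω | offspring (T ω) 0 1 + 1 = b} := by
    rw [lintegral_tsum (hind _ fun j => (hEm j).inter (hFm j)), ← hsum, ← ENNReal.tsum_mul_right]
    refine tsum_congr fun j => ?_
    rw [lintegral_indicator_one₀ ((hEm j).inter (hFm j))]
    exact h.measure_adj_inter a b j
  rw [integral_congr_ae hcount, integral_toReal, hEF]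
  · exact AEMeasurable.tsum (hind _ fun j => (hEm j).inter (hFm j))
  · filter_upwards [hroot] with ω hω
    refine lt_of_le_of_lt (ENNReal.tsum_le_tsum fun j => Set.indicator_le_indicator_of_subset
      Set.inter_subset_left (fun _ => zero_le) ω) ?_
    rw [hω]
    exact lt_of_le_of_lt (Set.indicator_le_self _ _ _) (ENNReal.natCast_lt_top a)

/-- The law of the degree of a non-root vertex is the size-biased law of the degree of the root. -/
theorem exists_sizeBiased [IsProbabilityMeasure P] (h : IsExploredTree P T) (hT : Measurable T)
    {Ωn : ℕ → Type*} [∀ n, MeasurableSpace (Ωn n)]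
    {Pn : ∀ n, Measure (Ωn n)} [∀ n, IsProbabilityMeasure (Pn n)]
    {G : ∀ n, Ωn n → SimpleGraph (Fin n)}
    (hdeg : ∀ᶠ n in atTop, ∀ᵐ ω ∂(Pn n), ∀ v, 3 ≤ deg (G n ω) v)
    (hloc : LocallyConvergesInProbability Pn G P fun ω => rootedComponent (T ω) 0) :
    ∃ c : ℝ≥0∞, c ≠ 0 ∧ c ≠ ⊤ ∧
      (∀ a : ℕ, (a : ℝ≥0∞) * P {ω | offspring (T ω) 0 0 = a}
        = c * P {ω | offspring (T ω) 0 1 + 1 = a}) ∧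
      ∀ b < 3, P {ω | offspring (T ω) 0 1 + 1 = b} = 0 := by
  set p : ℕ → ℝ≥0∞ := fun a => P {ω | offspring (T ω) 0 0 = a} with hp
  set q : ℕ → ℝ≥0∞ := fun b => P {ω | offspring (T ω) 0 1 + 1 = b} with hq
  have htop : ∀ a b : ℕ, (a : ℝ≥0∞) * p a * q b ≠ ⊤ := fun a b =>
    ENNReal.mul_ne_top (ENNReal.mul_ne_top (ENNReal.natCast_ne_top a) (measure_ne_top _ _))
      (measure_ne_top _ _)
  have hsymm : ∀ a b : ℕ, (a : ℝ≥0∞) * p a * q b = (b : ℝ≥0∞) * p b * q a := fun a b => by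
    rw [← ENNReal.toReal_eq_toReal_iff' (htop a b) (htop b a), ← h.integral_edgeCount hT a b,
      ← h.integral_edgeCount hT b a]
    exact hloc.integral_eq (RootedGraph.edgeCountBCF a b) (RootedGraph.edgeCountBCF b a)
      (Eventually.of_forall fun n => ae_of_all _ fun ω => sum_edgeCount_rootedComponent_comm _ a b)
  -- Edges to vertices of degree below 3 are absent from `G n` for large n, so their count is
  -- compared with the zero function.
  have hzero : ∀ a b : ℕ, b < 3 → (a : ℝ≥0∞) * p a * q b = 0 := fun a b hb => by
    have h0 := hloc.integral_eq (RootedGraph.edgeCountBCF a b) 0 (by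
      filter_upwards [hdeg] with n hn
      filter_upwards [hn] with ω hω
      refine Finset.sum_congr rfl fun i _ => ?_
      change RootedGraph.edgeCount a b (rootedComponent (G n ω) i) = 0
      rw [edgeCount_rootedComponent fun _ => Set.toFinite _]
      have hempty : {j | (G n ω).Adj i j ∧ deg (G n ω) j = b} = ∅ := by
        ext j
        simp only [Set.mem_ofPred_eq, Set.mem_empty_iff_false, iff_false, not_and]
        intro _ hj
        have := hω j
        omega
      rw [hempty]
      simp)
    have h1 := h.integral_edgeCount hT a b
    have h2 : ∫ ω, RootedGraph.edgeCount a b (rootedComponent (T ω) 0) ∂P = 0 := by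
      rw [show (0 : ℝ) = ∫ ω, (0 : RootedGraph →ᵇ ℝ) (rootedComponent (T ω) 0) ∂P by simp]
      exact h0
    rw [h2, eq_comm, ENNReal.toReal_eq_zero_iff] at h1
    exact h1.resolve_right (htop a b)
  have hex : ∀ {X : Ω → ℕ}, ∃ n, P {ω | X ω = n} ≠ 0 := by
    intro X
    by_contra! hX
    have : P (⋃ n, {ω | X ω = n}) = 0 := measure_iUnion_null hX
    rw [show (⋃ n, {ω | X ω = n}) = Set.univ from Set.eq_univ_of_forall fun ω =>
      Set.mem_iUnion.mpr ⟨X ω, rfl⟩, measure_univ] at this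
    exact one_ne_zero this
  obtain ⟨a₀, ha₀⟩ : ∃ a, p a ≠ 0 := hex
  obtain ⟨b₀, hb₀⟩ : ∃ b, q b ≠ 0 := hex
  have ha₀' : (a₀ : ℝ≥0∞) ≠ 0 := by
    rw [Nat.cast_ne_zero]
    rintro rfl
    refine ha₀ (measure_eq_zero_iff_ae_notMem.mpr ?_)
    filter_upwards [h.one_le] with ω hω h0
    have h1 := hω 0
    have h2 : offspring (T ω) 0 0 = 0 := h0
    omega
  have hb₀top : q b₀ ≠ ⊤ := measure_ne_top _ _
  -- The symmetry relation with b = b₀, divided by q b₀, forces this constant.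
  refine ⟨(b₀ : ℝ≥0∞) * p b₀ / q b₀, ?_, ?_, fun a => ?_, fun b hb => ?_⟩
  · refine ENNReal.div_ne_zero.mpr ⟨fun h0 => ?_, hb₀top⟩
    have := hsymm b₀ a₀
    rw [h0, zero_mul] at this
    exact mul_ne_zero (mul_ne_zero ha₀' ha₀) hb₀ this.symm
  · exact ENNReal.div_ne_top (ENNReal.mul_ne_top (ENNReal.natCast_ne_top _) (measure_ne_top _ _)) hb₀
  · change (a : ℝ≥0∞) * p a = (b₀ : ℝ≥0∞) * p b₀ / q b₀ * q a
    rw [div_eq_mul_inv, mul_right_comm, ← hsymm a b₀, mul_assoc, ENNReal.mul_inv_cancel hb₀ hb₀top,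
      mul_one]
  · exact (mul_eq_zero.mp (hzero a₀ b hb)).resolve_left (mul_ne_zero ha₀' ha₀)

end IsExploredTree

/-! ### Non-backtracking exploration -/

theorem lintegral_comp_nat {Ω : Type*} [MeasurableSpace Ω] {P : Measure Ω} {X : Ω → ℕ}
    (hX : AEMeasurable X P) (f : ℕ → ℝ≥0∞) :
    ∫⁻ ω, f (X ω) ∂P = ∑' n, f n * P {ω | X ω = n} := by
  rw [← lintegral_map' (f := f) Measurable.of_discrete.aemeasurable hX, lintegral_countable']
  refine tsum_congr fun n => ?_
  rw [Measure.map_apply_of_aemeasurable hX (MeasurableSet.singleton n)]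
  rfl

theorem integral_natCast_pow {Ω : Type*} [MeasurableSpace Ω] {P : Measure Ω} {X : Ω → ℕ}
    (hX : AEMeasurable X P) (m : ℕ) :
    ∫ ω, (X ω : ℝ) ^ m ∂P = (∫⁻ ω, (X ω : ℝ≥0∞) ^ m ∂P).toReal := by
  rw [← integral_toReal]
  · simp
  · exact (Measurable.of_discrete (f := fun n : ℕ => (n : ℝ≥0∞) ^ m)).comp_aemeasurable hX
  · exact ae_of_all _ fun ω => ENNReal.pow_lt_top (ENNReal.natCast_lt_top _)

namespace IsExploredTree

variable {Ω : Type*} [MeasurableSpace Ω] {P : Measure Ω} {T : Ω → SimpleGraph ℕ}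

/-- The walk enters j from a smaller label i, and the mass at i, the adjacency of i and j, and the
offspring number of i are all fixed by the offspring numbers below j. -/
theorem determinedBelow_walkProb (h : IsExploredTree P T) (k j : ℕ) :
    DeterminedBelow P (fun l ω => offspring (T ω) 0 l) j
      fun ω => walkProb (nonBacktrackingStep (T ω) 0) 0 k j := by
  classical
  induction k generalizing j with
  | zero => exact DeterminedBelow.const j _
  | succ k ih =>
    have hsum : DeterminedBelow P (fun l ω => offspring (T ω) 0 l) j fun ω =>
        ∑ i ∈ Finset.range j, walkProb (nonBacktrackingStep (T ω) 0) 0 k i *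
          if (T ω).Adj i j then 1 / (offspring (T ω) 0 i : ℝ) else 0 := by
      refine DeterminedBelow.finset_sum fun i hi => ?_
      have hij := Finset.mem_range.mp hi
      exact ((ih i).mono hij.le).map₂ ((h.determined i j hij).map₂ (DeterminedBelow.of_lt hij)
        fun (p : Prop) (n : ℕ) => if p then 1 / (n : ℝ) else 0) (· * ·)
    refine hsum.congr ?_
    filter_upwards [h.isTree, h.lt] with ω h1 h2
    exact (walkProb_succ_eq_sum_range h1 h2 k j).symm

theorem deg_eq (h : IsExploredTree P T) :
    ∀ᵐ ω ∂P, ∀ j, deg (T ω) (j + 1) = offspring (T ω) 0 (j + 1) + 1 := by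
  filter_upwards [h.isTree, h.locallyFinite] with ω h1 h2 j
  exact deg_eq_offspring_add_one h1 (h2 _) (Nat.succ_ne_zero j)

theorem aemeasurable_nonBacktrackingBias (h : IsExploredTree P T) (k : ℕ) :
    AEMeasurable (fun ω => nonBacktrackingBias (T ω) 0 k) P := by
  have hcast : Measurable fun n : ℕ => (n : ℝ) := Measurable.of_discrete
  have hdeg : ∀ j, AEMeasurable (fun ω => (deg (T ω) j : ℝ)) P := fun j => by
    cases j with
    | zero =>
      simp only [← offspring_root]
      exact hcast.comp_aemeasurable (h.aemeasurable 0)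
    | succ j =>
      refine ((hcast.comp_aemeasurable (h.aemeasurable (j + 1))).add_const 1).congr ?_
      filter_upwards [h.deg_eq] with ω hω
      simp [hω]
  exact (AEMeasurable.tsum fun j =>
    ((h.determinedBelow_walkProb k j).aemeasurable h.aemeasurable).mul (hdeg j)).sub (hdeg 0)

/-- After at least one step the walk has left the root for good, so each position has degree one
more than its offspring number; the weights sum to 1 and the constant μ + 1 splits off. -/
theorem nonBacktrackingBias_succ_eq (h : IsExploredTree P T) (μ : ℝ) (k : ℕ) :
    ∀ᵐ ω ∂P, nonBacktrackingBias (T ω) 0 (k + 1)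
      = ∑' j, walkProb (nonBacktrackingStep (T ω) 0) 0 (k + 1) (j + 1)
          * ((offspring (T ω) 0 (j + 1) : ℝ) - μ) + (μ + 1 - offspring (T ω) 0 0) := by
  filter_upwards [h.deg_eq, h.locallyFinite, h.one_le] with ω h1 h2 h3
  set W := walkProb (nonBacktrackingStep (T ω) 0) 0 (k + 1) with hW
  have hsm : ∀ f : ℕ → ℝ, Summable fun j => W j * f j := fun f =>
    summable_of_hasFiniteSupport ((walkProb_support_finite
      (nonBacktrackingStep_support_finite h2) 0 (k + 1)).subset fun j hj => left_ne_zero_of_mul hj)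
  have hshift : ∀ f : ℕ → ℝ, ∑' j, W j * f j = ∑' j, W (j + 1) * f (j + 1) := fun f => by
    rw [(hsm f).tsum_eq_zero_add, hW, walkProb_succ_root, zero_mul, zero_add]
  have hone : ∑' j, W (j + 1) * 1 = 1 := by
    rw [← hshift fun _ => 1]
    simpa only [mul_one] using tsum_walkProb_eq_one (nonBacktrackingStep_support_finite h2)
      (fun i => tsum_nonBacktrackingStep h2 (h3 i)) 0 (k + 1)
  rw [nonBacktrackingBias, levelBias, hshift fun j => (deg (T ω) j : ℝ), ← offspring_root]
  have hsplit : ∀ j, W (j + 1) * (deg (T ω) (j + 1) : ℝ)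
      = W (j + 1) * ((offspring (T ω) 0 (j + 1) : ℝ) - μ) + (μ + 1) * (W (j + 1) * 1) := fun j => by
    rw [h1]
    push_cast
    ring
  simp_rw [hsplit]
  rw [Summable.tsum_add, tsum_mul_left, hone]
  · ring
  · exact (summable_nat_add_iff 1).mpr (hsm fun j => (offspring (T ω) 0 j : ℝ) - μ)
  · exact ((summable_nat_add_iff 1).mpr (hsm fun _ => 1)).mul_left _

/-- A law of large numbers: the walk spreads over so many vertices that the weighted fluctuations of
the offspring numbers average out. -/
theorem tendsto_eLpNorm_nonBacktrackingBias [IsProbabilityMeasure P] (h : IsExploredTree P T)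
    (h2 : ∀ᵐ ω ∂P, ∀ i, 2 ≤ offspring (T ω) 0 i)
    (hL2 : MemLp (fun ω => (offspring (T ω) 0 1 : ℝ)) 2 P) :
    Tendsto (fun k => eLpNorm ((fun ω => nonBacktrackingBias (T ω) 0 k)
      - fun ω => ∫ ω', (offspring (T ω') 0 1 : ℝ) ∂P + 1 - offspring (T ω) 0 0) 2 P)
      atTop (𝓝 0) := by
  set μ := ∫ ω, (offspring (T ω) 0 1 : ℝ) ∂P with hμ
  set φ : ℕ → ℝ := fun n => (n : ℝ) - μ with hφ
  have hid : ∀ j, IdentDistrib (fun ω => φ (offspring (T ω) 0 (j + 1)))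
      (fun ω => φ (offspring (T ω) 0 1)) P P := fun j =>
    (h.identDistrib j).comp (u := φ) Measurable.of_discrete
  have hφ1 : MemLp (fun ω => φ (offspring (T ω) 0 1)) 2 P := hL2.sub (memLp_const μ)
  have hmean1 : ∫ ω, φ (offspring (T ω) 0 1) ∂P = 0 := by
    simp only [hφ]
    rw [integral_sub (hL2.integrable one_le_two) (integrable_const _)]
    simp [hμ]
  set s := ∫ ω, φ (offspring (T ω) 0 1) ^ 2 ∂P with hs
  have hbound : ∀ k, eLpNorm ((fun ω => nonBacktrackingBias (T ω) 0 (k + 1))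
      - fun ω => μ + 1 - offspring (T ω) 0 0) 2 P
      ≤ ENNReal.ofReal ((s * (1 / 2) ^ (k + 1)) ^ (2⁻¹ : ℝ)) := fun k => by
    refine le_trans (eLpNorm_congr_ae ?_).le (eLpNorm_two_tsum_le (φ := φ)
      (W := fun j ω => walkProb (nonBacktrackingStep (T ω) 0) 0 (k + 1) j)
      (d := fun l ω => offspring (T ω) 0 l) h.aemeasurable h.indep
      (h.determinedBelow_walkProb (k + 1)) (pow_le_one₀ (by norm_num) (by norm_num))
      (ae_of_all _ fun ω j => walkProb_nonneg nonBacktrackingStep_nonneg 0 _ j) ?_ ?_ ?_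
      (fun j => (hid j).symm.memLp_snd hφ1)
      (fun j => (hid j).integral_eq.trans hmean1) fun j => ?_)
    · filter_upwards [h.nonBacktrackingBias_succ_eq μ k] with ω hω
      rw [Pi.sub_apply, hω, add_sub_cancel_right]
    · filter_upwards [h.isTree, h2] with ω h3 h4 j
      exact walkProb_le_half_pow h3 h4 _ j
    · filter_upwards [h.locallyFinite] with ω h3
      exact walkProb_support_finite (nonBacktrackingStep_support_finite h3) 0 (k + 1)
    · filter_upwards [h.locallyFinite, h.one_le] with ω h3 h4
      exact (tsum_walkProb_eq_one (nonBacktrackingStep_support_finite h3)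
        (fun i => tsum_nonBacktrackingStep h3 (h4 i)) 0 (k + 1)).le
    · exact ((hid j).comp (u := fun x : ℝ => x ^ 2) (by fun_prop)).integral_eq
  rw [← tendsto_add_atTop_iff_nat 1]
  refine tendsto_of_tendsto_of_tendsto_of_le_of_le tendsto_const_nhds ?_
    (fun _ => zero_le) hbound
  have h3 : Tendsto (fun k : ℕ => s * (1 / 2 : ℝ) ^ (k + 1)) atTop (𝓝 0) := by
    simpa using ((tendsto_pow_atTop_nhds_zero_of_lt_one (r := (1 / 2 : ℝ)) (by norm_num)
      (by norm_num)).comp (tendsto_add_atTop_nat 1)).const_mul s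
  have h4 := ENNReal.tendsto_ofReal (h3.rpow_const (p := (2⁻¹ : ℝ)) (Or.inr (by norm_num)))
  simpa using h4

/-- If the degree of a non-root vertex has the size-biased law of the degree of the root, then the
second moment of the latter is finite, and its quotient by the first moment is the mean of the
former. -/
theorem memLp_and_moment_ratio [IsProbabilityMeasure P] (h : IsExploredTree P T)
    (hL2 : MemLp (fun ω => (offspring (T ω) 0 1 : ℝ)) 2 P) {c : ℝ≥0∞} (hc0 : c ≠ 0) (hc : c ≠ ⊤)
    (hbias : ∀ a : ℕ, (a : ℝ≥0∞) * P {ω | offspring (T ω) 0 0 = a}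
        = c * P {ω | offspring (T ω) 0 1 + 1 = a}) :
    MemLp (fun ω => (offspring (T ω) 0 0 : ℝ)) 2 P ∧
    (∫ ω, (offspring (T ω) 0 0 : ℝ) ^ 2 ∂P) / (∫ ω, (offspring (T ω) 0 0 : ℝ) ∂P)
      = ∫ ω, (offspring (T ω) 0 1 : ℝ) ∂P + 1 := by
  have hm0 := h.aemeasurable 0
  have hR : AEMeasurable (fun ω => offspring (T ω) 0 1 + 1) P := (h.aemeasurable 1).add_const 1
  have hRint : Integrable (fun ω => ((offspring (T ω) 0 1 + 1 : ℕ) : ℝ)) P := by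
    simp only [Nat.cast_add, Nat.cast_one]
    exact (hL2.integrable one_le_two).add (integrable_const 1)
  -- Summing the size-bias relation over a identifies c as the mean root degree.
  have hfirst : ∫⁻ ω, (offspring (T ω) 0 0 : ℝ≥0∞) ∂P = c := by
    rw [lintegral_comp_nat hm0 fun n => (n : ℝ≥0∞)]
    simp_rw [hbias]
    rw [ENNReal.tsum_mul_left]
    have h1 := lintegral_comp_nat hR fun _ => 1
    simp only [lintegral_const, measure_univ, one_mul] at h1
    rw [← h1, mul_one]
  -- Since n² p_n = c n q_n, the second moment at the root costs only a first moment elsewhere.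
  have hsecond : ∫⁻ ω, (offspring (T ω) 0 0 : ℝ≥0∞) ^ 2 ∂P
      = c * ∫⁻ ω, ((offspring (T ω) 0 1 + 1 : ℕ) : ℝ≥0∞) ∂P := by
    rw [lintegral_comp_nat hm0 fun n => (n : ℝ≥0∞) ^ 2, lintegral_comp_nat hR fun n => (n : ℝ≥0∞),
      ← ENNReal.tsum_mul_left]
    refine tsum_congr fun n => ?_
    rw [sq, mul_assoc, hbias, mul_left_comm]
  have hRfin : ∫⁻ ω, ((offspring (T ω) 0 1 + 1 : ℕ) : ℝ≥0∞) ∂P ≠ ⊤ := by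
    have := hRint.2
    simp only [HasFiniteIntegral, Real.enorm_natCast] at this
    exact this.ne
  have hcast : Measurable fun n : ℕ => (n : ℝ) := Measurable.of_discrete
  have hD : AEMeasurable (fun ω => (offspring (T ω) 0 0 : ℝ)) P := hcast.comp_aemeasurable hm0
  refine ⟨(memLp_two_iff_integrable_sq hD.aestronglyMeasurable).mpr
    ⟨(hD.pow_const 2).aestronglyMeasurable, ?_⟩, ?_⟩
  · simp only [HasFiniteIntegral, enorm_pow, Real.enorm_natCast, hsecond]
    exact (ENNReal.mul_ne_top hc hRfin).lt_top
  · have h1 := integral_natCast_pow hm0 1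
    have h2 := integral_natCast_pow hm0 2
    have h3 := integral_natCast_pow hR 1
    simp only [pow_one] at h1 h3
    rw [h1, h2, hfirst, hsecond, ENNReal.toReal_mul, mul_div_cancel_left₀ _
      (ENNReal.toReal_ne_zero.mpr ⟨hc0, hc⟩), ← h3]
    simp only [Nat.cast_add, Nat.cast_one]
    rw [integral_add (hL2.integrable one_le_two) (integrable_const 1)]
    simp

/-- Away from the root the degree is at least 3, parent included. At the root, the size-bias
relation at a = 1 rules out a single offspring, and zero is excluded by `one_le`. -/
theorem two_le_offspring (h : IsExploredTree P T) {c : ℝ≥0∞}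
    (hbias : ∀ a : ℕ, (a : ℝ≥0∞) * P {ω | offspring (T ω) 0 0 = a}
        = c * P {ω | offspring (T ω) 0 1 + 1 = a})
    (hq : ∀ b < 3, P {ω | offspring (T ω) 0 1 + 1 = b} = 0) :
    ∀ᵐ ω ∂P, ∀ i, 2 ≤ offspring (T ω) 0 i := by
  rw [ae_all_iff]
  have hne : ∀ b < 3, ∀ᵐ ω ∂P, offspring (T ω) 0 1 + 1 ≠ b := fun b hb =>
    measure_eq_zero_iff_ae_notMem.mp (hq b hb)
  intro i
  cases i with
  | zero =>
    have hp : P {ω | offspring (T ω) 0 0 = 1} = 0 := by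
      have := hbias 1
      rwa [hq 1 (by norm_num), mul_zero, Nat.cast_one, one_mul] at this
    filter_upwards [measure_eq_zero_iff_ae_notMem.mp hp, h.one_le] with ω h1 h2
    have h3 : offspring (T ω) 0 0 ≠ 1 := h1
    have := h2 0
    omega
  | succ i =>
    refine (h.identDistrib i).symm.ae_mem_snd (t := {n | 2 ≤ n}) MeasurableSet.of_discrete ?_
    filter_upwards [hne 1 (by norm_num), hne 2 (by norm_num)] with ω h1 h2
    omega

end IsExploredTree

end FriendBias

open FriendBias in
theorem theorem3p3 :
    -- non-backtracking exploration
    (∀ {Ωn : ℕ → Type*} [∀ n, MeasurableSpace (Ωn n)]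
        (Pn : ∀ n, Measure (Ωn n)) [∀ n, IsProbabilityMeasure (Pn n)]
        (G : ∀ n, Ωn n → SimpleGraph (Fin n)) (_ : ∀ n, Measurable (G n))
        (_ : ∀ᶠ n in atTop, ∀ᵐ ω ∂(Pn n), ∀ v, 3 ≤ deg (G n ω) v)
        {Ω : Type*} [MeasurableSpace Ω] (P : Measure Ω) [IsProbabilityMeasure P]
        -- the limit tree: vertex set `ℕ`, root `0`
        (T : Ω → SimpleGraph ℕ) (_ : Measurable T)
        (_ : ∀ᵐ ω ∂P, (T ω).IsTree)
        (_ : ∀ᵐ ω ∂P, ∀ v, ((T ω).neighborSet v).Finite)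
        (_ : ∀ᵐ ω ∂P, ∀ v, 1 ≤ offspring (T ω) 0 v)
        (_ : IsExplorationLabelling P T)
        (_ : LocallyConvergesInProbability Pn G P (fun ω => rootedComponent (T ω) 0))
        -- the root offspring number is independent of the others
        (_ : IndepFun (fun ω => offspring (T ω) 0 0) (fun ω (i : ℕ) => offspring (T ω) 0 (i + 1)) P)
        -- the other offspring numbers are i.i.d. with finite second moment
        (_ : iIndepFun (fun (i : ℕ) ω => offspring (T ω) 0 (i + 1)) P)
        (_ : ∀ i : ℕ, IdentDistrib (fun ω => offspring (T ω) 0 (i + 1))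
          (fun ω => offspring (T ω) 0 1) P P)
        (_ : MemLp (fun ω => (offspring (T ω) 0 1 : ℝ)) 2 P),
      -- the moments of `d_φ` are finite
      MemLp (fun ω => (offspring (T ω) 0 0 : ℝ)) 2 P ∧
      TendstoInMeasure P (fun k ω => nonBacktrackingBias (T ω) 0 k) atTop
        (fun ω => (∫ ω', (offspring (T ω') 0 0 : ℝ) ^ 2 ∂P) /
          (∫ ω', (offspring (T ω') 0 0 : ℝ) ∂P) - (offspring (T ω) 0 0 : ℝ)) ∧
      TendstoInDistribution (fun k ω => nonBacktrackingBias (T ω) 0 k) atTop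
        (fun ω => (∫ ω', (offspring (T ω') 0 0 : ℝ) ^ 2 ∂P) /
          (∫ ω', (offspring (T ω') 0 0 : ℝ) ∂P) - (offspring (T ω) 0 0 : ℝ)) (fun _ => P) P) ∧
    -- backtracking exploration
    (∀ {Ω : Type*} [MeasurableSpace Ω] (P : Measure Ω) [IsProbabilityMeasure P]
        (X : Ω → RootedGraph) (_ : Measurable X)
        (_ : ∀ᵐ ω ∂P, Finite (X ω).V)
        (_ : ∀ᵐ ω ∂P, ¬ (X ω).graph.IsBipartite),
      (∀ᵐ ω ∂P, Tendsto (fun k => backtrackingBias (X ω).graph (X ω).root k) atTop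
        (𝓝 (stationaryBias (X ω).graph (X ω).root))) ∧
      TendstoInDistribution (fun k ω => backtrackingBias (X ω).graph (X ω).root k) atTop
        (fun ω => stationaryBias (X ω).graph (X ω).root) (fun _ => P) P) := by
  refine ⟨?_, fun P _ X hX hfin hbip => backtracking_convergence P X hX hfin hbip⟩
  intro Ωn _ Pn _ G _ hdeg Ω _ P _ T hT htree hlf hone hexp hloc h0 hind hid hL2
  have haem : ∀ l, AEMeasurable (fun ω => offspring (T ω) 0 l) P := fun l => by
    cases l with
    | zero =>
      simp only [offspring_root]
      exact aemeasurable_deg hT (hlf.mono fun ω hω => hω 0)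
    | succ l => exact (hid l).aemeasurable_fst
  have h : IsExploredTree P T :=
    { isTree := htree
      locallyFinite := hlf
      one_le := hone
      lt := hexp.1
      determined := fun i j hij => by
        obtain ⟨S, hS⟩ := hexp.2 i j hij
        exact ⟨fun x => x ∈ S, hS.mono fun ω hω => propext hω⟩
      aemeasurable := haem
      indep := iIndepFun.indepFun_initial (iIndepFun_of_head_tail h0 hind) haem
      identDistrib := hid }
  obtain ⟨c, hc0, hc, hbias, hq⟩ := h.exists_sizeBiased hT hdeg hloc
  obtain ⟨hmem, hratio⟩ := h.memLp_and_moment_ratio hL2 hc0 hc hbias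
  have hlim := h.tendsto_eLpNorm_nonBacktrackingBias (h.two_le_offspring hbias hq) hL2
  -- The limit takes the form E[d_1] + 1 - d_φ, in which the L^2 estimate is stated.
  rw [hratio]
  have hmeas := h.aemeasurable_nonBacktrackingBias
  have hconv := tendstoInMeasure_of_tendsto_eLpNorm two_ne_zero
    (fun k => (hmeas k).aestronglyMeasurable) (aestronglyMeasurable_const.sub hmem.aestronglyMeasurable) hlim
  exact ⟨hmem, hconv, hconv.tendstoInDistribution hmeas⟩
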